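/- **Conventions.** A *doctrine* is a functor $P:\mathcal C^{op}\to\mathbf{PreOrd}$, with no restriction on $\mathcal C$. $\mathcal C\rtimes P$ is the category of pairs $(c,x)$ with $x\in P(c)$; an arrow $(c,x)\to(d,y)$ is an arrow $f:c\to d$ of $\mathcal C$ with $x\le P(f)(y)$, and $p_P:\mathcal C\rtimes P\to\mathcal C$ is the projection. A *doctrinal site* $(P,J)$ is a doctrine $P$ with a Grothendieck topology $J$ on $\mathcal C\rtimes P$. A *morphism of doctrinal sites* $(F,a):(P,J)\to(Q,K)$, with $Q:\mathcal D^{op}\to\mathbf{PreOrd}$, is a functor $F:\mathcal C\to\mathcal D$ that is flat (a morphism of sites, in the sense of SGA 4, for the trivial topologies) and a natural transformation $a:P\to Q\circ F^{op}$ such that $F\rtimes a:(\mathcal C\rtimes P,J)\to(\mathcal D\rtimes Q,K)$, $(c,x)\mapsto(F(c),a_c(x))$, is a morphism of sites. A *geometric doctrine* is a functor $\mathbb L$ from $\mathcal C^{op}$ to frames whose transition maps $\mathbb L(f)$ have left adjoints $\exists_f$ satisfying Frobenius reciprocity $\exists_f(U\wedge \mathbb L(f)V)=\exists_fU\wedge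 V$, and which satisfies the relative Beck–Chevalley condition: if a sieve $S$ on $(d,V)$ in $\mathcal C\rtimes\mathbb L$ has $V=\bigvee_{f\in S}\exists_f U$ (the join over all arrows $f:(c,U)\to(d,V)$ of $S$), then for each $h:e\to d$ one has $\mathbb L(h)(V)=\bigvee_{g\in h^*S}\exists_g W$, where $h^*S$ is the pulled back sieve on $(e,\mathbb L(h)(V))$. Then $K_{\mathbb L}$ denotes the Grothendieck topology on $\mathcal C\rtimes\mathbb L$ whose covering sieves on $(d,V)$ are those with $V=\bigvee_{f\in S}\exists_fU$; a morphism of geometric doctrines is a morphism of the doctrinal sites $(\mathbb L,K_{\mathbb L})$. For a site $(\mathcal A,J)$, $J\text{-}\mathrm{Flat}(\mathcal A,\mathbf{Sets})$ is the category of functors $G:\mathcal A\to\mathbf{Sets}$ whose category of elements is cofiltered and which send $J$-covering sieves to jointly surjective families, with natural transformations as arrows. The desired models of a geometric doctrine are $\mathrm{Mod}(\mathbb L)=K_{\mathbb L}\text{-}\mathrm{Flat}(\mathcal C\rtimes\mathbb L,\mathbf{Sets})$. In (ii), $\mathbf{Sets}$ is the category of sets of a universe in which $\mathcal C$ and $P$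 are small. **Theorem.** Let $(P,J)$ be a doctrinal site over $\mathcal C$. For $c\in\mathcal C$ let $\mathfrak Z(P,J)(c)$ be the set, ordered by inclusion, of all sets $S$ of pairs $(f,x)$, $f:d\to c$, $x\in P(d)$, such that $(f,x)\in S$ implies $(f\circ g,y)\in S$ whenever $g:e\to d$ and $y\le P(g)(x)$, and such that $(f,x)\in S$ whenever the arrows $g:(e,y)\to(d,x)$ with $(f\circ g,y)\in S$ form a $J$-covering sieve; for $f:d\to c$ let $\mathfrak Z(P,J)(f)(S)=\{(g,y)\mid(f\circ g,y)\in S\}$. This is a geometric doctrine, *the geometric completion*. Let $\eta:P\to\mathfrak Z(P,J)$ send $x\in P(c)$ to the $J$-closure of $\{(g,y)\mid y\le P(g)(x)\}$. Then: - (o) $\mathfrak Z(P,J)$ is isomorphic, as a presheaf on $\mathcal C$, to the direct image $C_{p_P*}(\Omega)$ of the subobject classifier $\Omega$ (the sheaf of $J$-closed sieves) of $\mathbf{Sh}(\mathcal C\rtimes P,J)$ along the geometric morphism to $\mathbf{Sets}^{\mathcal C^{op}}$ induced by the comorphism of sites $p_P$, by an isomorphism under which $S\in\mathfrak Z(P,J)(c)$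 and $x\in P(c)$ yield the closed sieve $\{g:(e,y)\to(c,x)\mid(g,y)\in S\}$; and $(\mathrm{id}_{\mathcal C},\eta):(P,J)\to(\mathfrak Z(P,J),K_{\mathfrak Z(P,J)})$ is a morphism of doctrinal sites. - (i) *Universality.* For each geometric doctrine $\mathbb L:\mathcal D^{op}\to\mathbf{Frm}_{\mathrm{open}}$ and each morphism of doctrinal sites $(F,a):(P,J)\to(\mathbb L,K_{\mathbb L})$ there is a unique natural transformation $\mathfrak a:\mathfrak Z(P,J)\to\mathbb L\circ F^{op}$ such that $(F,\mathfrak a)$ is a morphism of geometric doctrines and $\mathfrak a\circ\eta=a$. - (ii) *Semantic invariance.* If a category $\mathrm{Mod}(P)$ is equivalent to $J\text{-}\mathrm{Flat}(\mathcal C\rtimes P,\mathbf{Sets})$, then $\mathrm{Mod}(P)\simeq\mathrm{Mod}(\mathfrak Z(P,J))$. - (iii) *Idempotency.* $\mathfrak Z(P,J)\cong\mathfrak Z(\mathfrak Z(P,J),K_{\mathfrak Z(P,J)})$ as geometric doctrines over $\mathcal C$; the isomorphism is given by the unit of $(\mathfrak Z(P,J),K_{\mathfrak Z(P,J)})$.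 -/

import Mathlib

open CategoryTheory Opposite

universe t v₃ u₃ w₂ v₂ u₂ w v u

namespace Doctrines

/-! ### Doctrines and their total categories -/

/-- A doctrine: a functor from `Cᵒᵖ` to the category of preorders. -/
abbrev Doctrine (C : Type u) [Category.{v} C] := Cᵒᵖ ⥤ Preord.{w}

section Total

variable {C : Type u} [Category.{v} C]

/-- Objects of the Grothendieck construction `C ⋊ P`: pairs `(c, x)` with `x ∈ P(c)`. -/
structure TotalCat (P : Doctrine.{w} C) where
  base : C
  elt : P.obj (op base)

/-- An arrow `(c, x) ⟶ (d, y)` of `C ⋊ P` is an arrow `f : c ⟶ d` with `x ≤ P(f)(y)`. -/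
@[ext]
structure TotalCat.Hom {P : Doctrine.{w} C} (X Y : TotalCat P) where
  base : X.base ⟶ Y.base
  elt_le : X.elt ≤ P.map base.op Y.elt

instance TotalCat.category (P : Doctrine.{w} C) : Category.{v} (TotalCat P) where
  Hom X Y := TotalCat.Hom X Y
  id X := ⟨𝟙 X.base, by simp⟩
  comp {X Y Z} f g := ⟨f.base ≫ g.base, by
    rw [op_comp, P.map_comp]
    exact f.elt_le.trans ((P.map f.base.op).hom.monotone g.elt_le)⟩
  id_comp f := TotalCat.Hom.ext (Category.id_comp f.base)
  comp_id f := TotalCat.Hom.ext (Category.comp_id f.base)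
  assoc f g h := TotalCat.Hom.ext (Category.assoc f.base g.base h.base)

/-- The projection `p_P : C ⋊ P ⥤ C`. -/
def proj (P : Doctrine.{w} C) : TotalCat P ⥤ C where
  obj X := X.base
  map f := f.base

/-- The cartesian arrow `(e, P(h)(y)) ⟶ (d, y)` over `h : e ⟶ d`. -/
def cartesianLift (P : Doctrine.{w} C) {d e : C} (h : e ⟶ d) (y : P.obj (op d)) :
    (⟨e, P.map h.op y⟩ : TotalCat P) ⟶ ⟨d, y⟩ :=
  ⟨h, le_rfl⟩

end Total

section Trans

variable {C : Type u} [Category.{v} C] {D : Type u₂} [Category.{v₂} D]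

/-- A natural transformation `a : P ⟶ Q ∘ Fᵒᵖ` of preorder-valued functors
(the fibres of `P` and `Q` may live in different universes). -/
structure DocTrans (F : C ⥤ D) (P : Doctrine.{w} C) (Q : Doctrine.{w₂} D) where
  app (c : C) : P.obj (op c) →o Q.obj (op (F.obj c))
  naturality {c d : C} (f : d ⟶ c) (x : P.obj (op c)) :
    app d (P.map f.op x) = Q.map (F.map f).op (app c x)

/-- The functor `F ⋊ a : C ⋊ P ⥤ D ⋊ Q`. -/
def DocTrans.total {F : C ⥤ D} {P : Doctrine.{w} C} {Q : Doctrine.{w₂} D} (a : DocTrans F P Q) :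
    TotalCat P ⥤ TotalCat Q where
  obj X := ⟨F.obj X.base, a.app X.base X.elt⟩
  map {X Y} f := ⟨F.map f.base, by
    have h := (a.app X.base).monotone f.elt_le
    rwa [a.naturality] at h⟩
  map_id X := TotalCat.Hom.ext (F.map_id X.base)
  map_comp f g := TotalCat.Hom.ext (F.map_comp f.base g.base)

/-! ### Morphisms of sites and of doctrinal sites -/

/-- Morphisms of sites (SGA 4), for possibly non-cartesian categories. -/
structure IsMorphismOfSites (J : GrothendieckTopology C) (K : GrothendieckTopology D)
    (F : C ⥤ D) : Prop where
  cover_preserving {c : C} {S : Sieve c} : S ∈ J c → S.functorPushforward F ∈ K (F.obj c)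
  covered (d : D) : ∃ R ∈ K d, ∀ ⦃d' : D⦄ (h : d' ⟶ d), R h →
    ∃ c : C, Nonempty (d' ⟶ F.obj c)
  pair {c₁ c₂ : C} {d : D} (g₁ : d ⟶ F.obj c₁) (g₂ : d ⟶ F.obj c₂) :
    ∃ R ∈ K d, ∀ ⦃d' : D⦄ (h : d' ⟶ d), R h →
      ∃ (c' : C) (f₁ : c' ⟶ c₁) (f₂ : c' ⟶ c₂) (k : d' ⟶ F.obj c'),
        h ≫ g₁ = k ≫ F.map f₁ ∧ h ≫ g₂ = k ≫ F.map f₂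
  equalize {c' c : C} (f₁ f₂ : c' ⟶ c) {d : D} (g : d ⟶ F.obj c')
    (hg : g ≫ F.map f₁ = g ≫ F.map f₂) :
    ∃ R ∈ K d, ∀ ⦃d' : D⦄ (h : d' ⟶ d), R h →
      ∃ (c'' : C) (e : c'' ⟶ c') (k : d' ⟶ F.obj c''),
        e ≫ f₁ = e ≫ f₂ ∧ h ≫ g = k ≫ F.map e

/-- The functor `F` is flat: a morphism of sites for the trivial topologies. -/
def IsFlat (F : C ⥤ D) : Prop := IsMorphismOfSites ⊥ ⊥ F

/-- The pair `(F, a)` is a morphism of doctrinal sites `(P, J) ⟶ (Q, K)`. -/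
structure IsDocSiteMorphism {P : Doctrine.{w} C} {Q : Doctrine.{w₂} D}
    (J : GrothendieckTopology (TotalCat P)) (K : GrothendieckTopology (TotalCat Q))
    (F : C ⥤ D) (a : DocTrans F P Q) : Prop where
  flat : IsFlat F
  total : IsMorphismOfSites J K a.total

end Trans

/-! ### Geometric doctrines (internal locales of presheaf toposes) -/

/-- The underlying preorder of a frame, as a functor. -/
abbrev frmToPreord : Frm.{w} ⥤ Preord.{w} where
  obj L := Preord.of L
  map f := Preord.ofHom (f.hom : _ →o _)

section Geometric

variable (C : Type u) [Category.{v} C]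

/-- A functor `Cᵒᵖ ⥤ Frm_open`: a functor to frames, each of whose transition maps has a
left adjoint `∃_f` satisfying the Frobenius condition. -/
structure OpenFrameDoctrine where
  frm : Cᵒᵖ ⥤ Frm.{w}
  ex {d c : C} (f : d ⟶ c) : frm.obj (op d) → frm.obj (op c)
  gc {d c : C} (f : d ⟶ c) : GaloisConnection (ex f) (frm.map f.op)
  frobenius {d c : C} (f : d ⟶ c) (U : frm.obj (op d)) (V : frm.obj (op c)) :
    ex f (U ⊓ frm.map f.op V) = ex f U ⊓ V

variable {C}

/-- The underlying doctrine of a functor to open frames. -/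
abbrev OpenFrameDoctrine.doc (L : OpenFrameDoctrine.{w} C) : Doctrine.{w} C :=
  L.frm ⋙ frmToPreord

/-- The second component of an object `(c, U)` of `C ⋊ L`, as an element of the frame `L(c)`. -/
abbrev OpenFrameDoctrine.val (L : OpenFrameDoctrine.{w} C) (X : TotalCat L.doc) :
    L.frm.obj (op X.base) := X.elt

/-- The join `⋁_{f ∈ S} ∃_f U`, over all arrows `f : (c, U) ⟶ (d, V)` of a sieve `S`
on `(d, V)`. -/
noncomputable def OpenFrameDoctrine.join (L : OpenFrameDoctrine.{w} C) {X : TotalCat L.doc}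
    (S : Sieve X) : L.frm.obj (op X.base) :=
  ⨆ (Y : TotalCat L.doc) (f : Y ⟶ X) (_ : S f), L.ex f.base (L.val Y)

variable (C) in
/-- A geometric doctrine, i.e. an internal locale of the topos of presheaves on `C`: a functor
`Cᵒᵖ ⥤ Frm_open` satisfying the relative Beck-Chevalley condition. -/
structure GeometricDoctrine extends OpenFrameDoctrine.{w} C where
  beckChevalley {d e : C} (h : e ⟶ d) (V : frm.obj (op d))
    (S : Sieve (⟨d, V⟩ : TotalCat toOpenFrameDoctrine.doc)) :
    toOpenFrameDoctrine.join S = V →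
      toOpenFrameDoctrine.join
        (S.pullback (cartesianLift toOpenFrameDoctrine.doc h V)) = frm.map h.op V

theorem OpenFrameDoctrine.le_map_ex (L : OpenFrameDoctrine.{w} C) {d c : C} (f : d ⟶ c)
    (U : L.frm.obj (op d)) : U ≤ L.frm.map f.op (L.ex f U) := (L.gc f).le_u_l U

theorem OpenFrameDoctrine.ex_comp_le (L : OpenFrameDoctrine.{w} C) {e d c : C} (g : e ⟶ d)
    (f : d ⟶ c) (U : L.frm.obj (op e)) : L.ex f (L.ex g U) ≤ L.ex (g ≫ f) U := by
  refine (L.gc f).l_le ((L.gc g).l_le ?_)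
  have h := L.le_map_ex (g ≫ f) U
  rwa [op_comp, L.frm.map_comp] at h

theorem OpenFrameDoctrine.le_join (L : OpenFrameDoctrine.{w} C) {X : TotalCat L.doc}
    (S : Sieve X) {Y : TotalCat L.doc} (f : Y ⟶ X) (hf : S f) : L.ex f.base (L.val Y) ≤ L.join S :=
  le_iSup_of_le Y (le_iSup_of_le f (le_iSup_of_le hf le_rfl))

theorem OpenFrameDoctrine.join_le_iff (L : OpenFrameDoctrine.{w} C) {X : TotalCat L.doc}
    (S : Sieve X) (V : L.frm.obj (op X.base)) :
    L.join S ≤ V ↔ ∀ (Y : TotalCat L.doc) (f : Y ⟶ X), S f → L.ex f.base (L.val Y) ≤ V := by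
  simp only [OpenFrameDoctrine.join, iSup_le_iff]

theorem OpenFrameDoctrine.join_le (L : OpenFrameDoctrine.{w} C) {X : TotalCat L.doc}
    (S : Sieve X) : L.join S ≤ L.val X :=
  (L.join_le_iff S _).2 fun _ f _ => (L.gc f.base).l_le f.elt_le

/-- The Grothendieck topology `K_L` on `C ⋊ L`: a sieve on `(d, V)` is covering when
`V = ⋁ ∃_f U` over its arrows `f : (c, U) ⟶ (d, V)`. -/
def GeometricDoctrine.topology (L : GeometricDoctrine.{w} C) :
    GrothendieckTopology (TotalCat L.doc) where
  sieves X := {S | L.join S = L.val X}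
  top_mem' X := by
    refine le_antisymm (L.join_le _) ?_
    refine le_trans ?_ (L.le_join ⊤ (𝟙 X) trivial)
    have h := L.le_map_ex (𝟙 X.base) (L.val X)
    rw [op_id, L.frm.map_id] at h
    exact h
  pullback_stable' := by
    intro X Y S f hS
    refine le_antisymm (L.join_le _) ?_
    have h1 : L.val Y ≤ L.frm.map f.base.op (L.val X) := f.elt_le
    have h2 := L.beckChevalley f.base (L.val X) S hS
    have h3 := le_inf (le_refl (L.val Y)) (h1.trans h2.ge)
    refine h3.trans ?_
    simp only [OpenFrameDoctrine.join, inf_iSup_eq]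
    refine iSup_le fun Z => iSup_le fun g => iSup_le fun hg => ?_
    rw [inf_comm, ← L.frobenius]
    let W : L.frm.obj (op Z.base) := L.val Z ⊓ L.frm.map g.base.op (L.val Y)
    let Z' : TotalCat L.doc := ⟨Z.base, W⟩
    let g' : Z' ⟶ Y := ⟨g.base, (inf_le_right : W ≤ _)⟩
    refine L.le_join (S.pullback f) g' ?_
    let i : Z' ⟶ Z := ⟨𝟙 _, by
      rw [op_id, L.doc.map_id]
      exact (inf_le_left : W ≤ _)⟩
    have h4 := S.downward_closed hg i
    have h5 : i ≫ g ≫ cartesianLift L.doc f.base (L.val X) = g' ≫ f := by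
      apply TotalCat.Hom.ext
      change 𝟙 _ ≫ g.base ≫ f.base = g.base ≫ f.base
      simp
    change S (g' ≫ f)
    rw [← h5]
    exact h4
  transitive' := by
    intro X S hS R hR
    refine le_antisymm (L.join_le _) ?_
    refine (le_of_eq (Eq.symm hS)).trans ((L.join_le_iff S _).2 fun Y f hf => ?_)
    have h1 : L.join (R.pullback f) = L.val Y := hR hf
    refine (L.gc f.base).l_le ?_
    rw [← h1]
    refine (L.join_le_iff _ _).2 fun Z g hg => ?_
    refine ((L.gc f.base).le_iff_le).1 ?_
    exact (L.ex_comp_le g.base f.base (L.val Z)).trans (L.le_join R (g ≫ f) hg)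

end Geometric

/-! ### The geometric completion -/

section Completion

variable {C : Type u} [Category.{v} C] (P : Doctrine.{w} C)

/-- A set of pairs `(f, x)`, with `f : d ⟶ c` and `x ∈ P(d)`, such that `(f, x) ∈ S` implies
`(f ∘ g, y) ∈ S` whenever `y ≤ P(g)(x)`. Equivalently, a subobject of the presheaf
`Hom(p_P(-), c)` on `C ⋊ P`. We write `f ∈ S.mem (d, x)` for `(f, x) ∈ S`. -/
@[ext]
structure DownSet (c : C) where
  mem (X : TotalCat P) : Set (X.base ⟶ c)
  down {X Y : TotalCat P} (g : Y ⟶ X) {f : X.base ⟶ c} : f ∈ mem X → g.base ≫ f ∈ mem Y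

variable {P}

/-- For `f : d ⟶ c` and `x ∈ P(d)`, the sieve on `(d, x)` of all `g : (e, y) ⟶ (d, x)` with
`(f ∘ g, y) ∈ S`. -/
def DownSet.sieve {c : C} (S : DownSet P c) {X : TotalCat P} (f : X.base ⟶ c) : Sieve X where
  arrows Y g := g.base ≫ f ∈ S.mem Y
  downward_closed {Y Z g} hg h := by
    have := S.down h hg
    rwa [← Category.assoc] at this

variable (J : GrothendieckTopology (TotalCat P))

/-- The set `S` is `J`-closed: `(f, x) ∈ S` as soon as `(f ∘ h_i, y_i) ∈ S` for all members of a
`J`-covering family of arrows `h_i : (e_i, y_i) ⟶ (d, x)`. -/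
def DownSet.IsClosed {c : C} (S : DownSet P c) : Prop :=
  ∀ ⦃X : TotalCat P⦄ (f : X.base ⟶ c), S.sieve f ∈ J X → f ∈ S.mem X

/-- The `J`-closed sets of pairs `(f, x)` over `c`. -/
def ClosedSet (c : C) := {S : DownSet P c // S.IsClosed J}

namespace ClosedSet

variable {J}

/-- Membership of the pair `(f, x)`, where `X = (d, x)` and `f : d ⟶ c`. -/
def mem {c : C} (S : ClosedSet J c) (X : TotalCat P) : Set (X.base ⟶ c) := S.1.mem X

theorem ext {c : C} {S T : ClosedSet J c}
    (h : ∀ (X : TotalCat P) (f : X.base ⟶ c), f ∈ S.mem X ↔ f ∈ T.mem X) : S = T :=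
  Subtype.ext (DownSet.ext (funext fun X => Set.ext (h X)))

theorem down {c : C} (S : ClosedSet J c) {X Y : TotalCat P} (g : Y ⟶ X) {f : X.base ⟶ c}
    (hf : f ∈ S.mem X) : g.base ≫ f ∈ S.mem Y := S.1.down g hf

theorem closed {c : C} (S : ClosedSet J c) {X : TotalCat P} (f : X.base ⟶ c)
    (R : Sieve X) (hR : R ∈ J X)
    (h : ∀ (Y : TotalCat P) (g : Y ⟶ X), R g → g.base ≫ f ∈ S.mem Y) : f ∈ S.mem X :=
  S.2 f (J.superset_covering (fun Y g hg => h Y g hg) hR)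

end ClosedSet

/-- The `J`-closure of a set `S` of pairs: `(f, x)` is in the closure if and only if the arrows
`g : (e, y) ⟶ (d, x)` with `(f ∘ g, y) ∈ S` form a `J`-covering sieve. -/
def DownSet.closure {c : C} (S : DownSet P c) : ClosedSet J c :=
  ⟨{ mem := fun X => {f | S.sieve f ∈ J X}
     down := by
      intro X Y g f hf
      refine J.superset_covering ?_ (J.pullback_stable g hf)
      intro Z h hh
      change h.base ≫ g.base ≫ f ∈ S.mem Z
      have : (h.base ≫ g.base) ≫ f ∈ S.mem Z := hh
      rwa [Category.assoc] at this }, by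
    intro X f hf
    refine J.transitive hf _ ?_
    intro Y g hg
    refine J.superset_covering ?_ hg
    intro Z h hh
    change (h.base ≫ g.base) ≫ f ∈ S.mem Z
    rw [Category.assoc]
    exact hh⟩

theorem DownSet.mem_closure_of_mem {c : C} (S : DownSet P c) {X : TotalCat P} {f : X.base ⟶ c}
    (hf : f ∈ S.mem X) : f ∈ (S.closure J).mem X := by
  change S.sieve f ∈ J X
  have : S.sieve f = ⊤ := by
    ext Y g
    exact ⟨fun _ => trivial, fun _ => S.down g hf⟩
  rw [this]
  exact J.top_mem X

namespace ClosedSet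

variable {J}

/-- Closed sets are ordered by inclusion. -/
instance (c : C) : PartialOrder (ClosedSet J c) where
  le S T := ∀ X : TotalCat P, S.mem X ⊆ T.mem X
  le_refl S X := subset_rfl
  le_trans S T U h h' X := (h X).trans (h' X)
  le_antisymm S T h h' := ext fun X _ => ⟨fun hf => h X hf, fun hf => h' X hf⟩

theorem closure_le_iff {c : C} (S : DownSet P c) (T : ClosedSet J c) :
    S.closure J ≤ T ↔ ∀ X : TotalCat P, S.mem X ⊆ T.mem X :=
  ⟨fun h X _ hf => h X (S.mem_closure_of_mem J hf),
    fun h _ f hf => T.closed f (S.sieve f) hf fun Y _ hg => h Y hg⟩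

/-- The union of a family of closed sets. -/
def union {c : C} (A : Set (ClosedSet J c)) : DownSet P c where
  mem X := {f | ∃ S ∈ A, f ∈ S.mem X}
  down := by
    rintro X Y g f ⟨S, hS, hf⟩
    exact ⟨S, hS, S.down g hf⟩

/-- The intersection of a family of closed sets. -/
def inter {c : C} (A : Set (ClosedSet J c)) : ClosedSet J c :=
  ⟨{ mem := fun X => {f | ∀ S ∈ A, f ∈ S.mem X}
     down := fun g _ hf S hS => S.down g (hf S hS) },
    fun _ f hf S hS => S.closed f _ hf fun _ _ hg => hg S hS⟩

/-- Meets are intersections, joins are closures of unions. -/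
instance (c : C) : CompleteLattice (ClosedSet J c) where
  sSup A := (union A).closure J
  isLUB_sSup A := ⟨fun S hS X f hf => (union A).mem_closure_of_mem J ⟨S, hS, hf⟩,
    fun T hT => (closure_le_iff _ _).2 fun X f hf => by
      obtain ⟨S, hS, hf⟩ := hf
      exact hT hS X hf⟩
  sInf A := inter A
  isGLB_sInf A := ⟨fun S hS _ _ hf => hf S hS, fun T hT X _ hf S hS => hT hS X hf⟩
  sup S T := (union {S, T}).closure J
  le_sup_left S T X f hf := (union {S, T}).mem_closure_of_mem J ⟨S, by simp, hf⟩
  le_sup_right S T X f hf := (union {S, T}).mem_closure_of_mem J ⟨T, by simp, hf⟩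
  sup_le S T U hS hT := (closure_le_iff _ _).2 fun X f hf => by
    obtain ⟨V, hV, hf⟩ := hf
    rcases hV with rfl | rfl
    · exact hS X hf
    · exact hT X hf
  inf S T := ⟨⟨fun X => S.mem X ∩ T.mem X, fun g _ hf => ⟨S.down g hf.1, T.down g hf.2⟩⟩,
    fun _ f hf => ⟨S.closed f _ hf fun _ _ hg => hg.1, T.closed f _ hf fun _ _ hg => hg.2⟩⟩
  inf_le_left S T X f hf := hf.1
  inf_le_right S T X f hf := hf.2
  le_inf S T U hT hU X f hf := ⟨hT X hf, hU X hf⟩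
  top := ⟨⟨fun _ => Set.univ, fun _ _ _ => trivial⟩, fun _ _ _ => trivial⟩
  le_top S X f hf := trivial
  bot := (union (J := J) (c := c) ∅).closure J
  bot_le S := (closure_le_iff (union ∅) S).2 fun X f hf => by
    obtain ⟨T, hT, _⟩ := hf
    exact hT.elim

theorem mem_sSup {c : C} (A : Set (ClosedSet J c)) (X : TotalCat P) (f : X.base ⟶ c) :
    f ∈ (sSup A).mem X ↔ (union A).sieve f ∈ J X := Iff.rfl

instance (c : C) : Order.Frame (ClosedSet J c) :=
  Order.Frame.ofMinimalAxioms
    { inf_sSup_le_iSup_inf := fun S A X f hf => by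
        refine ClosedSet.closed _ f _ hf.2 fun Y g hg => ?_
        obtain ⟨T, hT, hg⟩ := hg
        have h : S ⊓ T ≤ ⨆ b ∈ A, S ⊓ b := le_iSup₂_of_le T hT le_rfl
        exact h Y ⟨S.down g hf.1, hg⟩ }

/-- For `f : d ⟶ c`, the set `f^*(S) = {(g, y) | (f ∘ g, y) ∈ S}`. -/
def restrict {d c : C} (f : d ⟶ c) (S : ClosedSet J c) : ClosedSet J d :=
  ⟨{ mem := fun X => {g | g ≫ f ∈ S.mem X}
     down := fun {X Y} h {g} hg => by
      change (h.base ≫ g) ≫ f ∈ S.mem Y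
      rw [Category.assoc]
      exact S.down h hg },
    fun X g hg => S.closed (g ≫ f) _ hg fun Y h hh => by
      have : (h.base ≫ g) ≫ f ∈ S.mem Y := hh
      rwa [Category.assoc] at this⟩

theorem restrict_sSup {d c : C} (f : d ⟶ c) (A : Set (ClosedSet J c)) :
    restrict f (sSup A) = sSup (restrict f '' A) := by
  refine ext fun X g => ?_
  change (union A).sieve (g ≫ f) ∈ J X ↔ (union (restrict f '' A)).sieve g ∈ J X
  have : (union A).sieve (g ≫ f) = (union (restrict f '' A)).sieve g := by
    ext Y h
    constructor
    · rintro ⟨S, hS, hh⟩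
      refine ⟨_, ⟨S, hS, rfl⟩, ?_⟩
      change (h.base ≫ g) ≫ f ∈ S.mem Y
      rwa [Category.assoc]
    · rintro ⟨_, ⟨S, hS, rfl⟩, hh⟩
      refine ⟨S, hS, ?_⟩
      have : (h.base ≫ g) ≫ f ∈ S.mem Y := hh
      rwa [Category.assoc] at this
  rw [this]

/-- `f^*` as a frame homomorphism. -/
def restrictHom {d c : C} (f : d ⟶ c) : FrameHom (ClosedSet J c) (ClosedSet J d) where
  toFun := restrict f
  map_inf' _ _ := rfl
  map_top' := rfl
  map_sSup' := restrict_sSup f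

/-- For `f : d ⟶ c`, the set `{(f ∘ g, y) | (g, y) ∈ S}`. -/
def image {d c : C} (f : d ⟶ c) (S : ClosedSet J d) : DownSet P c where
  mem X := {k | ∃ g ∈ S.mem X, g ≫ f = k}
  down := by
    rintro X Y h k ⟨g, hg, rfl⟩
    exact ⟨h.base ≫ g, S.down h hg, Category.assoc _ _ _⟩

end ClosedSet

variable (P) in
/-- The functor `c ↦ {J-closed sets over c}`, with transition maps `f^*`, and the left adjoints
`∃_f` of the latter. -/
def completionOpen : OpenFrameDoctrine.{max u v w} C where
  frm :=
    { obj := fun c => Frm.of (ClosedSet J c.unop)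
      map := fun f => Frm.ofHom (ClosedSet.restrictHom f.unop)
      map_id := fun c => Frm.ext fun (S : ClosedSet J c.unop) => ClosedSet.ext fun X g => by
        change g ≫ 𝟙 _ ∈ S.mem X ↔ g ∈ S.mem X
        rw [Category.comp_id]
      map_comp := fun {c d e} f g => Frm.ext fun (S : ClosedSet J c.unop) =>
        ClosedSet.ext fun X h => by
          change h ≫ g.unop ≫ f.unop ∈ S.mem X ↔ (h ≫ g.unop) ≫ f.unop ∈ S.mem X
          rw [Category.assoc] }
  ex f S := (ClosedSet.image f S).closure J
  gc f S T := by
    refine (ClosedSet.closure_le_iff _ _).trans ⟨fun h X g hg => h X ⟨g, hg, rfl⟩, ?_⟩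
    rintro h X _ ⟨g, hg, rfl⟩
    exact h X hg
  frobenius {d c} f U V := by
    change ClosedSet J d at U
    change ClosedSet J c at V
    change (ClosedSet.image f (U ⊓ ClosedSet.restrict f V)).closure J =
      (ClosedSet.image f U).closure J ⊓ V
    apply le_antisymm
    · refine (ClosedSet.closure_le_iff _ _).2 ?_
      rintro X _ ⟨g, hg, rfl⟩
      exact ⟨DownSet.mem_closure_of_mem J _ ⟨g, hg.1, rfl⟩, hg.2⟩
    · rintro X k ⟨hk, hV⟩
      refine ClosedSet.closed _ k _ hk ?_
      rintro Y h ⟨g, hg, hgk⟩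
      refine DownSet.mem_closure_of_mem J _ ⟨g, ⟨hg, ?_⟩, hgk⟩
      change g ≫ f ∈ V.mem Y
      rw [hgk]
      exact V.down h hV

/-- The principal set `↓x = {(g, y) | y ≤ P(g)(x)}`. -/
def principal {c : C} (x : P.obj (op c)) : DownSet P c where
  mem X := {g | X.elt ≤ P.map g.op x}
  down {X Y} h {g} hg := by
    change Y.elt ≤ P.map (h.base ≫ g).op x
    rw [op_comp, P.map_comp]
    exact h.elt_le.trans ((P.map h.base.op).hom.monotone hg)

theorem principal_closure_le_iff {c : C} (x : P.obj (op c)) (S : ClosedSet J c) :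
    (principal x).closure J ≤ S ↔ 𝟙 c ∈ S.mem ⟨c, x⟩ := by
  rw [ClosedSet.closure_le_iff]
  constructor
  · intro h
    refine h ⟨c, x⟩ ?_
    change x ≤ P.map (𝟙 c).op x
    simp
  · intro h X g hg
    have := S.down (X := ⟨c, x⟩) (Y := X) ⟨g, hg⟩ h
    rwa [Category.comp_id] at this

theorem restrict_principal_closure {d c : C} (f : d ⟶ c) (x : P.obj (op c)) :
    ClosedSet.restrict f ((principal x).closure J) =
      (principal (P.map f.op x)).closure J := by
  refine ClosedSet.ext fun X g => ?_
  change (principal x).sieve (g ≫ f) ∈ J X ↔ (principal (P.map f.op x)).sieve g ∈ J X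
  have : (principal x).sieve (X := X) (g ≫ f) = (principal (P.map f.op x)).sieve g := by
    ext Y h
    change Y.elt ≤ P.map (h.base ≫ g ≫ f).op x ↔ Y.elt ≤ P.map (h.base ≫ g).op (P.map f.op x)
    rw [← Category.assoc, op_comp, P.map_comp]
    rfl
  rw [this]

variable (P) in
/-- The geometric completion `𝔍(P, J)` of a doctrinal site `(P, J)`. -/
def completion : GeometricDoctrine.{max u v w} C where
  toOpenFrameDoctrine := completionOpen P J
  beckChevalley {d e} h V S hS := by
    refine le_antisymm ((completionOpen P J).join_le _) ?_
    change ClosedSet J d at V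
    intro X k hk
    have hV : V ≤ (completionOpen P J).join S := hS.ge
    -- the set of pairs reached through `S`
    let T : DownSet P d :=
      { mem := fun X => {k | ∃ (Y : TotalCat (completionOpen P J).doc) (f : Y ⟶ ⟨d, V⟩)
            (_ : S f) (g : X.base ⟶ Y.base), g ∈ ClosedSet.mem (J := J) Y.elt X ∧
              g ≫ f.base = k}
        down := by
          rintro X X' i _ ⟨Y, f, hf, g, hg, rfl⟩
          exact ⟨Y, f, hf, i.base ≫ g, ClosedSet.down (J := J) _ i hg,
            Category.assoc _ _ _⟩ }
    have hT : (completionOpen P J).join S ≤ T.closure J := by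
      refine ((completionOpen P J).join_le_iff S _).2 fun Y f hf => ?_
      refine (ClosedSet.closure_le_iff _ _).2 ?_
      rintro X _ ⟨g, hg, rfl⟩
      exact DownSet.mem_closure_of_mem J T ⟨Y, f, hf, g, hg, rfl⟩
    have hk' : k ≫ h ∈ (T.closure J).mem X := hT X (hV X hk)
    refine ClosedSet.closed (J := J) _ k _ hk' ?_
    rintro X' i ⟨Y, f, hf, g, hg, hgf⟩
    -- the arrow `(X'.base, η X'.elt) ⟶ (e, h^* V)` of the pulled back sieve
    let Z : TotalCat (completionOpen P J).doc :=
      ⟨X'.base, (principal X'.elt).closure J⟩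
    let z : Z ⟶ Y := ⟨g, by
      refine (principal_closure_le_iff J X'.elt _).2 ?_
      change 𝟙 _ ≫ g ∈ ClosedSet.mem (J := J) Y.elt ⟨X'.base, X'.elt⟩
      rw [Category.id_comp]
      exact hg⟩
    let m : Z ⟶ ⟨e, (completionOpen P J).doc.map h.op V⟩ := ⟨i.base ≫ k, by
      refine (principal_closure_le_iff J X'.elt _).2 ?_
      change (𝟙 _ ≫ i.base ≫ k) ≫ h ∈ ClosedSet.mem (J := J) V X'
      rw [Category.id_comp, Category.assoc]
      exact V.down i hk⟩
    have hm : (S.pullback (cartesianLift (completionOpen P J).doc h V)) m := by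
      change S (m ≫ cartesianLift (completionOpen P J).doc h V)
      have : m ≫ cartesianLift (completionOpen P J).doc h V = z ≫ f := by
        apply TotalCat.Hom.ext
        change (i.base ≫ k) ≫ h = g ≫ f.base
        rw [hgf, Category.assoc]
      rw [this]
      exact S.downward_closed hf z
    refine (completionOpen P J).le_join _ m hm X' ?_
    refine DownSet.mem_closure_of_mem J _ ⟨𝟙 _, ?_, Category.id_comp _⟩
    exact (principal_closure_le_iff J X'.elt ((principal X'.elt).closure J)).1 le_rfl

variable (P) in
/-- The unit `η : P ⟶ 𝔍(P, J)`, sending `x` to the `J`-closure of `↓x`. -/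
def completionUnit : DocTrans (𝟭 C) P (completion P J).doc where
  app c :=
    { toFun := fun x => (principal x).closure J
      monotone' := fun x y hxy => by
        refine (principal_closure_le_iff J x _).2 (DownSet.mem_closure_of_mem J _ ?_)
        change x ≤ P.map (𝟙 c).op y
        simpa using hxy }
  naturality f x := (restrict_principal_closure J f x).symm

/-! ### The completion as a direct image of the subobject classifier -/

/-- The subobject classifier `Ω` of `Sh(C ⋊ P, J)`: the sheaf of `J`-closed sieves. -/
def omega : Sheaf J (Type (max u v w)) :=
  ⟨(Functor.closedSieves J).toFunctor,
    (isSheaf_iff_isSheaf_of_type _ _).2 (classifier_isSheaf J)⟩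

instance proj_isCocontinuous : (proj P).IsCocontinuous J ⊥ where
  cover_lift {X S} hS := by
    rw [GrothendieckTopology.bot_covering] at hS
    subst hS
    simp

variable (P) in
/-- The presheaf `(C_{p_P})_*(Ω)` on `C`, where `C_{p_P} : Sh(C ⋊ P, J) ⟶ PSh(C)` is the
geometric morphism induced by the comorphism of sites `p_P : (C ⋊ P, J) ⟶ (C, J_triv)`. -/
noncomputable def directImageOmega : Cᵒᵖ ⥤ Type (max u v w) :=
  (((proj P).sheafPushforwardCocontinuous (Type (max u v w)) J ⊥).obj (omega J)).obj

variable (P) in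
/-- The counit of the right Kan extension defining the direct image. -/
noncomputable def directImageCounit (X : TotalCat P) :
    (directImageOmega P J).obj (op X.base) ⟶ (omega J).obj.obj (op X) :=
  ((proj P).op.ranCounit.app (omega J).obj).app (op X)

/-- For `S ∈ 𝔍(P, J)(d)` and `x ∈ P(d)`, the `J`-closed sieve of all `g : (e, y) ⟶ (d, x)`
with `(g, y) ∈ S`. -/
def ClosedSet.toOmega (X : TotalCat P) (S : ClosedSet J X.base) :
    (omega J).obj.obj (op X) :=
  ⟨S.1.sieve (𝟙 X.base), fun Y g hg => by
    change g.base ≫ 𝟙 _ ∈ S.mem Y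
    refine S.closed _ _ hg fun Z h hh => ?_
    have : (h.base ≫ g.base) ≫ 𝟙 _ ∈ S.mem Z := hh
    rwa [Category.assoc] at this⟩

end Completion

/-! ### Models as continuous flat functors -/

section Models

variable {A : Type u} [Category.{v} A]

/-- The functor `G : A ⥤ Sets` is flat (its category of elements is cofiltered) and
`J`-continuous (covering sieves are sent to jointly surjective families). -/
structure IsContinuousFlat (J : GrothendieckTopology A) (G : A ⥤ Type t) : Prop where
  flat : IsCofiltered G.Elements
  continuous {a : A} {S : Sieve a} (hS : S ∈ J a) (s : G.obj a) :
    ∃ (b : A) (f : b ⟶ a) (_ : S f) (r : G.obj b), G.map f r = s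

/-- The category `J-Flat(A, Sets)` of `J`-continuous flat functors and natural
transformations. -/
abbrev ContinuousFlat (J : GrothendieckTopology A) :=
  ObjectProperty.FullSubcategory (IsContinuousFlat.{t} J)

end Models

end Doctrines

open Doctrines

/-!
# The geometric completion of a doctrinal site

Everything rests on two facts about the unit `η : P ⟶ 𝔍(P, J)`.

The functor `C ⋊ P ⥤ C ⋊ 𝔍(P, J)` induced by `η` exhibits `(C ⋊ P, J)` as a dense subsite: an arrow
from `η(W)` to an object `(c, V)` is the same as a pair `(k, x)` of the closed set `V`, and a sieve
on `(c, V)` is covering for the topology of the completion if and only if its inverse image along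
each such arrow is `J`-covering (`mem_completion_topology_iff`). Density makes `η` a morphism of
doctrinal sites (`isMorphismOfSites_of_isDenseSubsite`), and it gives semantic invariance: the
restriction of continuous flat functors along a dense subsite is an equivalence
(`continuousFlatEquivalence`). It is fully faithful because each element of a continuous flat
functor comes from an object of the subsite, and essentially surjective because a continuous flat
functor on the subsite is the restriction of its left Kan extension, which, by flatness, is a
quotient by an explicit equivalence relation (`flatExtension`).

A closed set `V` is the join of the `∃_k η(x)` over its pairs `(k, x)`, so an extension of
`a : P ⟶ L ∘ Fᵒᵖ` along `η` that preserves covers has to send `V` to the join of the `∃_{F(k)} a(x)`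
(`DocTrans.extendFun`). This formula has a right adjoint, which sends `U` to the closed set of all
`(k, x)` with `a(x) ≤ L(F(k))(U)`; hence it preserves covers. Its naturality is where the
Beck-Chevalley condition of `L` and the flatness of `F` enter (`DocTrans.extendFun_restrict`).

Idempotency holds for every geometric doctrine `L`: the extension of the identity of `L` inverts the
unit, because the join of a closed set of pairs is covered by its members and so belongs to the set.
Finally, a natural transformation from the inverse image of a presheaf `G` on `C` to the sheaf of
closed sieves is determined by where it takes the value "maximal sieve", which is a closed set of
pairs for each element of `G`; so the completion is the right Kan extension that defines the direct
image (`completionPresheaf_isRightKanExtension`).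
-/

namespace Doctrines

/-! ### Continuous flat functors on dense subsites -/

section Flat

variable {A : Type u} [Category.{v} A] {G : A ⥤ Type t}

theorem isCofiltered_elements_iff :
    IsCofiltered G.Elements ↔
      (∃ a, Nonempty (G.obj a)) ∧
      (∀ {a b : A} (x : G.obj a) (y : G.obj b), ∃ (c : A) (z : G.obj c) (f : c ⟶ a) (g : c ⟶ b),
        G.map f z = x ∧ G.map g z = y) ∧
      ∀ {a b : A} (f g : a ⟶ b) (x : G.obj a), G.map f x = G.map g x →
        ∃ (c : A) (z : G.obj c) (h : c ⟶ a), G.map h z = x ∧ h ≫ f = h ≫ g := by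
  constructor
  · intro hG
    refine ⟨?_, fun {a b} x y => ?_, fun {a b} f g x hx => ?_⟩
    · obtain ⟨⟨a, x⟩⟩ := hG.nonempty
      exact ⟨a, ⟨x⟩⟩
    · obtain ⟨W, f, g, -⟩ :=
        IsCofilteredOrEmpty.cone_objs (C := G.Elements) (G.elementsMk a x) (G.elementsMk b y)
      exact ⟨W.1, W.2, f.1, g.1, f.2, g.2⟩
    · obtain ⟨W, h, hh⟩ := IsCofilteredOrEmpty.cone_maps (C := G.Elements)
        (CategoryOfElements.homMk (G.elementsMk a x) (G.elementsMk b (G.map f x)) f rfl)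
        (CategoryOfElements.homMk (G.elementsMk a x) (G.elementsMk b (G.map f x)) g hx.symm)
      exact ⟨W.1, W.2, h.1, h.2, congrArg Subtype.val hh⟩
  · rintro ⟨⟨a, ⟨x⟩⟩, hpair, heq⟩
    exact
      { nonempty := ⟨⟨a, x⟩⟩
        cone_objs := fun ⟨a, x⟩ ⟨b, y⟩ => by
          obtain ⟨c, z, f, g, hf, hg⟩ := hpair x y
          exact ⟨⟨c, z⟩, ⟨f, hf⟩, ⟨g, hg⟩, trivial⟩
        cone_maps := fun ⟨a, x⟩ ⟨b, y⟩ f g => by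
          obtain ⟨c, z, h, hz, hh⟩ := heq f.1 g.1 x (f.2.trans g.2.symm)
          exact ⟨⟨c, z⟩, ⟨h, hz⟩, Subtype.ext hh⟩ }

end Flat

section Restriction

variable {A : Type u} [Category.{v} A] {B : Type u₂} [Category.{v₂} B]
  {J : GrothendieckTopology A} {K : GrothendieckTopology B} (F : A ⥤ B) [F.IsDenseSubsite J K]
  {G : B ⥤ Type t}

namespace IsContinuousFlat

include J in
theorem exists_from_image (hG : IsContinuousFlat K G) {b : B} (x : G.obj b) :
    ∃ (a : A) (h : F.obj a ⟶ b) (y : G.obj (F.obj a)), G.map h y = x := by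
  have := Functor.IsDenseSubsite.isCoverDense J K F
  obtain ⟨c, f, ⟨⟨a, l, m, hf⟩⟩, r, hr⟩ :=
    hG.continuous (F.is_cover_of_isCoverDense K b) x
  refine ⟨a, m, G.map l r, ?_⟩
  rw [← hr, ← hf]
  simp

theorem exists_of_cover (hG : IsContinuousFlat K G) {a : A} {S : Sieve a} (hS : S ∈ J a)
    (x : G.obj (F.obj a)) :
    ∃ (a' : A) (u : a' ⟶ a) (_ : S u) (y : G.obj (F.obj a')), G.map (F.map u) y = x := by
  obtain ⟨c, f, ⟨a', u, l, hu, hf⟩, r, hr⟩ :=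
    hG.continuous ((Functor.IsDenseSubsite.functorPushforward_mem_iff (G := F) (K := K)).2 hS) x
  refine ⟨a', u, hu, G.map l r, ?_⟩
  rw [← hr, hf]
  simp

include J in
/-- An arrow between objects in the image of `F` lifts to `A` after a refinement of its domain that
still carries a given element of `G`. -/
theorem exists_lift (hG : IsContinuousFlat K G) {a a' : A} (g : F.obj a ⟶ F.obj a')
    (x : G.obj (F.obj a)) :
    ∃ (a'' : A) (u : a'' ⟶ a) (l : a'' ⟶ a') (y : G.obj (F.obj a'')),
      F.map l = F.map u ≫ g ∧ G.map (F.map u) y = x := by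
  obtain ⟨a'', u, ⟨l, hl⟩, y, hy⟩ :=
    hG.exists_of_cover F (Functor.IsDenseSubsite.imageSieve_mem J K F g) x
  exact ⟨a'', u, l, y, hl, hy⟩

include J in
/-- Two arrows out of an object of `B` that carries an element of `G` can be replaced by arrows
in the image of `F`. -/
theorem exists_lift_pair (hG : IsContinuousFlat K G) {b : B} {a₁ a₂ : A} (g₁ : b ⟶ F.obj a₁)
    (g₂ : b ⟶ F.obj a₂) (x : G.obj b) :
    ∃ (a : A) (h : F.obj a ⟶ b) (l₁ : a ⟶ a₁) (l₂ : a ⟶ a₂) (y : G.obj (F.obj a)),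
      F.map l₁ = h ≫ g₁ ∧ F.map l₂ = h ≫ g₂ ∧ G.map h y = x := by
  obtain ⟨a, h, y, hy⟩ := hG.exists_from_image (J := J) F x
  obtain ⟨a', u, l, y', hl, hy'⟩ := hG.exists_lift (J := J) F (h ≫ g₁) y
  obtain ⟨a'', u', l', y'', hl', hy''⟩ := hG.exists_lift (J := J) F (F.map u ≫ h ≫ g₂) y'
  refine ⟨a'', F.map u' ≫ F.map u ≫ h, u' ≫ l, l', y'', by simp [hl], by simp [hl'], ?_⟩
  simp [hy'', hy', hy]

/-- Continuous flat functors restrict along a dense subsite. -/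
theorem comp (hG : IsContinuousFlat K G) : IsContinuousFlat J (F ⋙ G) where
  continuous hS x := hG.exists_of_cover F hS x
  flat := by
    obtain ⟨⟨b, ⟨x⟩⟩, hpair, heq⟩ := isCofiltered_elements_iff.1 hG.flat
    refine isCofiltered_elements_iff.2 ⟨?_, fun {a a'} x y => ?_, fun {a a'} f g x hx => ?_⟩
    · obtain ⟨a, -, y, -⟩ := hG.exists_from_image (J := J) F x
      exact ⟨a, ⟨y⟩⟩
    · obtain ⟨c, z, f, g, hf, hg⟩ := hpair x y
      obtain ⟨a'', h, l₁, l₂, y, h₁, h₂, hy⟩ := hG.exists_lift_pair (J := J) F f g z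
      refine ⟨a'', y, l₁, l₂, ?_, ?_⟩
      · simp [h₁, hy, hf]
      · simp [h₂, hy, hg]
    · obtain ⟨c, z, h, hz, hh⟩ := heq (F.map f) (F.map g) x hx
      obtain ⟨b, k, l, -, y, hl, -, hy⟩ := hG.exists_lift_pair (J := J) F h h z
      have he : F.map (l ≫ f) = F.map (l ≫ g) := by simp [hl, hh]
      obtain ⟨b', u, hu, y', hy'⟩ :=
        hG.exists_of_cover F (Functor.IsDenseSubsite.equalizer_mem J K F _ _ he) y
      refine ⟨b', y', u ≫ l, ?_, ?_⟩
      · simp [hl, hy', hy, hz]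
      · simpa using hu

end IsContinuousFlat

variable (J K)

/-- Restriction of continuous flat functors along a dense subsite. -/
def restrictFlat : ContinuousFlat.{t} K ⥤ ContinuousFlat.{t} J :=
  ObjectProperty.lift _
    (ObjectProperty.ι (IsContinuousFlat.{t} K) ⋙ (Functor.whiskeringLeft A B (Type t)).obj F)
    fun G => G.property.comp F

instance restrictFlat_faithful : (restrictFlat.{t} J K F).Faithful where
  map_injective {G H} α β h := by
    apply ObjectProperty.hom_ext
    ext b x
    obtain ⟨a, f, y, rfl⟩ := G.property.exists_from_image (J := J) F x
    have h' : α.hom.app (F.obj a) = β.hom.app (F.obj a) :=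
      congrArg (fun γ => γ.hom.app a) h
    simp [NatTrans.naturality_apply, h']

include J K in
/-- Fullness of restriction. An element of `G` at `b` is of the form `G(f)(y)` with `f : F a ⟶ b`, and
its image has to be `H(f)(α(y))`; two such presentations have, by flatness and local fullness, a
common refinement by arrows in the image of `F`. -/
theorem exists_extension {G H : B ⥤ Type t} (hG : IsContinuousFlat K G)
    (α : F ⋙ G ⟶ F ⋙ H) : ∃ β : G ⟶ H, F.whiskerLeft β = α := by
  have key : ∀ {b : B} {a a' : A} (f : F.obj a ⟶ b) (f' : F.obj a' ⟶ b) (y : G.obj (F.obj a))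
      (y' : G.obj (F.obj a')), G.map f y = G.map f' y' →
      H.map f (α.app a y) = H.map f' (α.app a' y') := by
    intro b a a' f f' y y' h
    obtain ⟨-, hpair, heq⟩ := isCofiltered_elements_iff.1 hG.flat
    obtain ⟨c, z, g, g', rfl, rfl⟩ := hpair y y'
    obtain ⟨c', z', k, rfl, hk⟩ := heq (g ≫ f) (g' ≫ f') z (by simpa using h)
    obtain ⟨d, m, l, l', x, hl, hl', rfl⟩ :=
      hG.exists_lift_pair (J := J) F (k ≫ g) (k ≫ g') z'
    have e₁ : G.map g (G.map k (G.map m x)) = (F ⋙ G).map l x := by simp [hl]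
    have e₂ : G.map g' (G.map k (G.map m x)) = (F ⋙ G).map l' x := by simp [hl']
    rw [e₁, e₂, NatTrans.naturality_apply, NatTrans.naturality_apply]
    have : F.map l ≫ f = F.map l' ≫ f' := by simp [hl, hl', hk]
    simpa using congrArg (fun q => H.map q (α.app d x)) this
  choose a f y hy using fun (b : B) (x : G.obj b) => hG.exists_from_image (J := J) F x
  refine ⟨{ app := fun b => ↾fun x => H.map (f b x) (α.app _ (y b x)), naturality := ?_ }, ?_⟩
  · intro b c g
    ext x
    have := key (f c (G.map g x)) (f b x ≫ g) (y c (G.map g x)) (y b x) (by simp [hy])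
    simpa using this
  · ext b x
    have := key (f _ x) (𝟙 _) (y _ x) x (by simp [hy])
    simpa using this

instance restrictFlat_full : (restrictFlat.{t} J K F).Full where
  map_surjective {G H} α := by
    obtain ⟨β, hβ⟩ := exists_extension J K F (H := H.obj) G.property α.hom
    exact ⟨ObjectProperty.homMk β, ObjectProperty.hom_ext _ hβ⟩

end Restriction

/-! ### Extension of flat functors and the comparison lemma -/

section Extension

variable {A : Type u} [Category.{v} A] {B : Type u₂} [Category.{v₂} B]

/-- An element of the extension along `F` of a set-valued functor `G`, at the object `b`, before
passing to the quotient: an arrow `F a ⟶ b` together with an element of `G(a)`. -/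
structure ExtensionPair (F : A ⥤ B) (G : A ⥤ Type t) (b : B) where
  obj : A
  hom : F.obj obj ⟶ b
  elt : G.obj obj

variable {F : A ⥤ B} {G : A ⥤ Type t}

/-- Two pairs are identified when they have a common refinement. For flat `G` this is the
equivalence relation that defines the colimit of `G` over the comma category of `F` over `b`. -/
def ExtensionPair.Rel {b : B} (p q : ExtensionPair F G b) : Prop :=
  ∃ (a : A) (z : G.obj a) (f : a ⟶ p.obj) (g : a ⟶ q.obj),
    G.map f z = p.elt ∧ G.map g z = q.elt ∧ F.map f ≫ p.hom = F.map g ≫ q.hom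

theorem ExtensionPair.rel_equivalence (hG : IsCofiltered G.Elements) (b : B) :
    Equivalence (ExtensionPair.Rel (F := F) (G := G) (b := b)) where
  refl p := ⟨p.obj, p.elt, 𝟙 _, 𝟙 _, by simp, by simp, rfl⟩
  symm := by
    rintro p q ⟨a, z, f, g, hf, hg, h⟩
    exact ⟨a, z, g, f, hg, hf, h.symm⟩
  trans := by
    rintro p q r ⟨a, z, f, g, hf, hg, h⟩ ⟨a', z', f', g', hf', hg', h'⟩
    obtain ⟨-, hpair, heq⟩ := isCofiltered_elements_iff.1 hG
    obtain ⟨c, x, k, k', rfl, rfl⟩ := hpair z z'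
    obtain ⟨d, y, m, rfl, hm⟩ := heq (k ≫ g) (k' ≫ f') x (by simp [hg, hf'])
    refine ⟨d, y, m ≫ k ≫ f, m ≫ k' ≫ g', by simpa using hf, by simpa using hg', ?_⟩
    have hm' : F.map m ≫ F.map k ≫ F.map g = F.map m ≫ F.map k' ≫ F.map f' := by
      simpa using congrArg F.map hm
    simp only [Functor.map_comp, Category.assoc, h, ← h']
    simpa using hm' =≫ q.hom

variable (F)

/-- The left Kan extension along `F` of a flat set-valued functor. -/
def flatExtension (hG : IsCofiltered G.Elements) : B ⥤ Type (max u v₂ t) where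
  obj b := Quotient ⟨_, ExtensionPair.rel_equivalence (F := F) hG b⟩
  map {b c} h := ↾Quotient.map (fun p => ⟨p.obj, p.hom ≫ h, p.elt⟩) (by
    rintro p q ⟨a, z, f, g, hf, hg, e⟩
    exact ⟨a, z, f, g, hf, hg, by simpa using e =≫ h⟩)
  map_id b := by
    ext x
    induction x using Quotient.inductionOn with | _ p
    simp
  map_comp f g := by
    ext x
    induction x using Quotient.inductionOn with | _ p
    simp

variable (hG : IsCofiltered G.Elements)

/-- The class of an arrow `F a ⟶ b` and an element of `G(a)`. -/
def flatExtension.mk {b : B} {a : A} (f : F.obj a ⟶ b) (x : G.obj a) :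
    (flatExtension F hG).obj b :=
  Quotient.mk _ ⟨a, f, x⟩

namespace flatExtension

theorem exists_eq_mk {b : B} (x : (flatExtension F hG).obj b) :
    ∃ (a : A) (f : F.obj a ⟶ b) (y : G.obj a), x = mk F hG f y := by
  induction x using Quotient.inductionOn with | _ p
  exact ⟨p.obj, p.hom, p.elt, rfl⟩

@[simp]
theorem map_mk {b c : B} (h : b ⟶ c) {a : A} (f : F.obj a ⟶ b) (x : G.obj a) :
    (flatExtension F hG).map h (mk F hG f x) = mk F hG (f ≫ h) x := rfl

theorem mk_eq_mk_iff {b : B} {a a' : A} (f : F.obj a ⟶ b) (x : G.obj a) (f' : F.obj a' ⟶ b)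
    (x' : G.obj a') :
    mk F hG f x = mk F hG f' x' ↔ ∃ (c : A) (z : G.obj c) (k : c ⟶ a) (k' : c ⟶ a'),
      G.map k z = x ∧ G.map k' z = x' ∧ F.map k ≫ f = F.map k' ≫ f' :=
  Quotient.eq (r := ⟨_, ExtensionPair.rel_equivalence (F := F) hG b⟩)

theorem mk_map {b : B} {a a' : A} (f : F.obj a ⟶ b) (k : a' ⟶ a) (x : G.obj a') :
    mk F hG f (G.map k x) = mk F hG (F.map k ≫ f) x :=
  (mk_eq_mk_iff F hG _ _ _ _).2 ⟨a', x, k, 𝟙 _, rfl, by simp, by simp⟩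

/-- The extension of a flat functor is flat. -/
theorem isCofiltered : IsCofiltered (flatExtension F hG).Elements := by
  obtain ⟨⟨a, ⟨x⟩⟩, hpair, heq⟩ := isCofiltered_elements_iff.1 hG
  refine isCofiltered_elements_iff.2
    ⟨⟨F.obj a, ⟨mk F hG (𝟙 _) x⟩⟩, fun {b b'} x y => ?_, fun {b b'} f g x hx => ?_⟩
  · obtain ⟨a, f, x, rfl⟩ := exists_eq_mk F hG x
    obtain ⟨a', f', y, rfl⟩ := exists_eq_mk F hG y
    obtain ⟨c, z, k, k', rfl, rfl⟩ := hpair x y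
    exact ⟨F.obj c, mk F hG (𝟙 _) z, F.map k ≫ f, F.map k' ≫ f', by simp [mk_map],
      by simp [mk_map]⟩
  · obtain ⟨a, l, x, rfl⟩ := exists_eq_mk F hG x
    rw [map_mk, map_mk, mk_eq_mk_iff] at hx
    obtain ⟨c, z, k, k', rfl, hk, e⟩ := hx
    obtain ⟨d, z, m, rfl, hm⟩ := heq k k' z hk.symm
    have e' : F.map (m ≫ k) ≫ l ≫ f = F.map (m ≫ k) ≫ l ≫ g := by
      conv_rhs => rw [hm]
      simpa using F.map m ≫= e
    exact ⟨F.obj d, mk F hG (𝟙 _) z, F.map (m ≫ k) ≫ l, by simp [mk_map], by simpa using e'⟩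

end flatExtension

variable {J : GrothendieckTopology A} {K : GrothendieckTopology B} [F.IsDenseSubsite J K]

namespace flatExtension

theorem isContinuousFlat (hG : IsContinuousFlat J G) :
    IsContinuousFlat K (flatExtension F hG.flat) where
  flat := isCofiltered F hG.flat
  continuous {b S} hS x := by
    obtain ⟨a, f, x, rfl⟩ := exists_eq_mk F hG.flat x
    obtain ⟨a', u, hu, y, rfl⟩ :=
      hG.continuous (F.cover_lift J K (K.pullback_stable f hS)) x
    exact ⟨F.obj a', F.map u ≫ f, hu, mk F hG.flat (𝟙 _) y, by simp [mk_map]⟩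

include J K in
theorem unit_bijective (hG : IsContinuousFlat J G) (a : A) :
    Function.Bijective (fun x : G.obj a => mk F hG.flat (𝟙 (F.obj a)) x) := by
  constructor
  · intro x x' h
    obtain ⟨c, z, k, k', rfl, rfl, e⟩ := (mk_eq_mk_iff F hG.flat _ _ _ _).1 h
    obtain ⟨d, u, hu, y, rfl⟩ :=
      hG.continuous (Functor.IsDenseSubsite.equalizer_mem J K F k k' (by simpa using e)) z
    have hu : u ≫ k = u ≫ k' := hu
    rw [← Functor.map_comp_apply, ← Functor.map_comp_apply, hu]
  · intro x
    obtain ⟨c, f, x, rfl⟩ := exists_eq_mk F hG.flat x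
    obtain ⟨d, u, ⟨l, hl⟩, y, rfl⟩ :=
      hG.continuous (Functor.IsDenseSubsite.imageSieve_mem J K F f) x
    exact ⟨G.map l y, by simp [mk_map, hl]⟩

end flatExtension

variable (J K)

/-- A continuous flat functor is the restriction of its extension along a dense subsite. -/
noncomputable def restrictFlatObjExtension (G : ContinuousFlat.{max u v₂ t} J) :
    (restrictFlat.{max u v₂ t} J K F).obj
      ⟨flatExtension F G.property.flat, flatExtension.isContinuousFlat F G.property⟩ ≅ G :=
  ObjectProperty.isoMk _ (NatIso.ofComponents
    (fun a => (Equiv.ofBijective _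
      (flatExtension.unit_bijective (J := J) (K := K) F G.property a)).toIso)
    (by
      intro a a' f
      ext x
      change flatExtension.mk F G.property.flat (𝟙 _) (G.obj.map f x) =
        flatExtension.mk F G.property.flat (𝟙 _ ≫ F.map f) x
      rw [flatExtension.mk_map, Category.comp_id, Category.id_comp])).symm

/-- The comparison lemma at the level of points: a dense subsite has the same continuous flat
functors as the ambient site. -/
noncomputable def continuousFlatEquivalence :
    ContinuousFlat.{max u v₂ t} K ≌ ContinuousFlat.{max u v₂ t} J :=
  have : (restrictFlat.{max u v₂ t} J K F).IsEquivalence :=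
    { essSurj := ⟨fun G => ⟨_, ⟨restrictFlatObjExtension.{t} F J K G⟩⟩⟩ }
  (restrictFlat.{max u v₂ t} J K F).asEquivalence

end Extension

/-! ### Dense subsites and morphisms of sites -/

section Dense

variable {A : Type u} [Category.{v} A] {B : Type u₂} [Category.{v₂} B]
  {J : GrothendieckTopology A} {K : GrothendieckTopology B} (F : A ⥤ B) [F.IsDenseSubsite J K]

include J in
/-- Covering sieves of a site can be tested on the objects of a dense subsite. -/
theorem mem_of_functorPullback_mem {b : B} {T : Sieve b}
    (h : ∀ (a : A) (m : F.obj a ⟶ b), (T.pullback m).functorPullback F ∈ J a) : T ∈ K b := by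
  have := Functor.IsDenseSubsite.isCoverDense J K F
  refine K.transitive (F.is_cover_of_isCoverDense K b) _ ?_
  rintro c _ ⟨⟨a, l, m, rfl⟩⟩
  rw [Sieve.pullback_comp]
  refine K.pullback_stable l (K.superset_covering ?_
    ((Functor.IsDenseSubsite.functorPushforward_mem_iff (G := F)).2 (h a m)))
  exact Sieve.functorPullback_pushforward_le F _

/-- A dense subsite is a morphism of sites. -/
theorem isMorphismOfSites_of_isDenseSubsite : IsMorphismOfSites J K F where
  cover_preserving hS := Functor.IsDenseSubsite.functorPushforward_mem_iff.2 hS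
  covered d := by
    have := Functor.IsDenseSubsite.isCoverDense J K F
    refine ⟨_, F.is_cover_of_isCoverDense K d, ?_⟩
    rintro d' h ⟨⟨a, l, -, -⟩⟩
    exact ⟨a, ⟨l⟩⟩
  pair {c₁ c₂ d} g₁ g₂ := by
    let R : Sieve d :=
      { arrows := fun d' h => ∃ (c' : A) (f₁ : c' ⟶ c₁) (f₂ : c' ⟶ c₂) (k : d' ⟶ F.obj c'),
          h ≫ g₁ = k ≫ F.map f₁ ∧ h ≫ g₂ = k ≫ F.map f₂
        downward_closed := by
          rintro d' d'' h ⟨c', f₁, f₂, k, h₁, h₂⟩ l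
          exact ⟨c', f₁, f₂, l ≫ k, by simp [h₁], by simp [h₂]⟩ }
    refine ⟨R, mem_of_functorPullback_mem (J := J) F fun a m => ?_, fun _ _ h => h⟩
    refine J.superset_covering ?_ (J.intersection_covering
      (Functor.IsDenseSubsite.imageSieve_mem J K F (m ≫ g₁))
      (Functor.IsDenseSubsite.imageSieve_mem J K F (m ≫ g₂)))
    rintro a' u ⟨⟨l₁, h₁⟩, ⟨l₂, h₂⟩⟩
    exact ⟨a', l₁, l₂, 𝟙 _, by simp [h₁], by simp [h₂]⟩
  equalize {c' c} f₁ f₂ d g hg := by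
    let R : Sieve d :=
      { arrows := fun d' h => ∃ (c'' : A) (e : c'' ⟶ c') (k : d' ⟶ F.obj c''),
          e ≫ f₁ = e ≫ f₂ ∧ h ≫ g = k ≫ F.map e
        downward_closed := by
          rintro d' d'' h ⟨c'', e, k, he, hk⟩ l
          exact ⟨c'', e, l ≫ k, he, by simp [hk]⟩ }
    refine ⟨R, mem_of_functorPullback_mem (J := J) F fun a m => ?_, fun _ _ h => h⟩
    refine J.transitive (Functor.IsDenseSubsite.imageSieve_mem J K F (m ≫ g)) _ ?_
    rintro a' u ⟨l, hl⟩
    refine J.superset_covering ?_ (Functor.IsDenseSubsite.equalizer_mem J K F (l ≫ f₁) (l ≫ f₂)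
      (by simp [hl, hg]))
    intro a'' v hv
    have hv : v ≫ l ≫ f₁ = v ≫ l ≫ f₂ := hv
    exact ⟨a'', v ≫ l, 𝟙 _, by simpa using hv, by simp [hl]⟩

end Dense

section Identity

variable {C : Type u} [Category.{v} C]

theorem isMorphismOfSites_id (J : GrothendieckTopology C) : IsMorphismOfSites J J (𝟭 C) where
  cover_preserving {c S} hS := by rwa [Sieve.functorPushforward_id]
  covered d := ⟨⊤, J.top_mem _, fun d' _ _ => ⟨d', ⟨𝟙 _⟩⟩⟩
  pair g₁ g₂ := ⟨⊤, J.top_mem _, fun d' h _ =>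
    ⟨d', h ≫ g₁, h ≫ g₂, 𝟙 _, (Category.id_comp _).symm, (Category.id_comp _).symm⟩⟩
  equalize {c' c} f₁ f₂ d g hg := ⟨⊤, J.top_mem _, fun d' h _ =>
    ⟨d', h ≫ g, 𝟙 _, by
      have hg : g ≫ f₁ = g ≫ f₂ := hg
      simp [hg], (Category.id_comp _).symm⟩⟩

theorem isFlat_id : IsFlat (𝟭 C) := isMorphismOfSites_id ⊥

theorem TotalCat.base_comp {P : Doctrine.{w} C} {X Y Z : TotalCat P} (f : X ⟶ Y) (g : Y ⟶ Z) :
    (f ≫ g).base = f.base ≫ g.base := rfl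

end Identity

/-! ### The unit of the completion is a dense subsite -/

section Unit

variable {C : Type u} [Category.{v} C] {P : Doctrine.{w} C} {J : GrothendieckTopology (TotalCat P)}

/-- The closed set in the second component of an object of the total category of the completion. -/
def closedSet (X : TotalCat (completion P J).doc) : ClosedSet J X.base := X.elt

/-- The functor from the total category of `P` to that of its completion induced by the unit. -/
def unitTotal (J : GrothendieckTopology (TotalCat P)) :
    TotalCat P ⥤ TotalCat (completion P J).doc :=
  (completionUnit P J).total

theorem mem_principal_closure_iff {c : C} (x : P.obj (op c)) {X : TotalCat P} (k : X.base ⟶ c) :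
    k ∈ ((principal x).closure J).mem X ↔ (principal x).sieve k ∈ J X := Iff.rfl

theorem self_mem_principal_closure (X : TotalCat P) :
    𝟙 X.base ∈ ((principal X.elt).closure J).mem X :=
  (principal_closure_le_iff J X.elt _).1 le_rfl

theorem principal_closure_le_restrict_iff {c d : C} (x : P.obj (op d)) (k : d ⟶ c)
    (S : ClosedSet J c) :
    (principal x).closure J ≤ ClosedSet.restrict k S ↔ k ∈ S.mem ⟨d, x⟩ := by
  rw [principal_closure_le_iff]
  change 𝟙 d ≫ k ∈ S.mem ⟨d, x⟩ ↔ _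
  rw [Category.id_comp]

theorem base_mem_closedSet {W : TotalCat P} {X : TotalCat (completion P J).doc}
    (h : (unitTotal J).obj W ⟶ X) : h.base ∈ (closedSet X).mem W :=
  (principal_closure_le_restrict_iff W.elt h.base (closedSet X)).1 h.elt_le

/-- A pair `(k, x)` in a closed set, as an arrow of the total category of the completion. -/
def arrowOfMem {W : TotalCat P} {X : TotalCat (completion P J).doc} (k : W.base ⟶ X.base)
    (hk : k ∈ (closedSet X).mem W) : (unitTotal J).obj W ⟶ X where
  base := k
  elt_le := (principal_closure_le_restrict_iff W.elt k (closedSet X)).2 hk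

/-- The pairs that factor through an arrow of a sieve. -/
def sieveUnion {X : TotalCat (completion P J).doc} (T : Sieve X) : DownSet P X.base where
  mem W := {k | ∃ (Y : TotalCat (completion P J).doc) (f : Y ⟶ X) (_ : T f)
    (g : W.base ⟶ Y.base), g ∈ (closedSet Y).mem W ∧ g ≫ f.base = k}
  down := by
    rintro W W' i _ ⟨Y, f, hf, g, hg, rfl⟩
    exact ⟨Y, f, hf, i.base ≫ g, ClosedSet.down _ i hg, Category.assoc _ _ _⟩

theorem join_le_sieveUnion_closure {X : TotalCat (completion P J).doc} (T : Sieve X) :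
    (completion P J).join T ≤ (sieveUnion T).closure J := by
  refine ((completionOpen P J).join_le_iff T _).2 fun Y f hf => ?_
  refine (ClosedSet.closure_le_iff _ _).2 ?_
  rintro W _ ⟨g, hg, rfl⟩
  exact DownSet.mem_closure_of_mem J _ ⟨Y, f, hf, g, hg, rfl⟩

/-- A sieve of the completion is covering if and only if its inverse image along the unit is
covering over each object coming from the original doctrinal site. -/
theorem mem_completion_topology_iff {X : TotalCat (completion P J).doc} {T : Sieve X} :
    T ∈ (completion P J).topology X ↔ ∀ (W : TotalCat P) (h : (unitTotal J).obj W ⟶ X),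
      (T.pullback h).functorPullback (unitTotal J) ∈ J W := by
  constructor
  · intro hT W h
    have hT : (completion P J).join T = closedSet X := hT
    have hV : closedSet X ≤ (sieveUnion T).closure J :=
      le_trans hT.ge (join_le_sieveUnion_closure T)
    refine J.superset_covering ?_ (hV W (base_mem_closedSet h))
    rintro W' g ⟨Y, f, hf, m, hm, e⟩
    change T ((unitTotal J).map g ≫ h)
    have : (unitTotal J).map g ≫ h = arrowOfMem m hm ≫ f := TotalCat.Hom.ext e.symm
    rw [this]
    exact T.downward_closed hf _
  · intro h
    refine le_antisymm ((completion P J).join_le T) ?_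
    change closedSet X ≤ (completion P J).join T
    intro W k hk
    refine ClosedSet.closed (J := J) _ k _ (h W (arrowOfMem k hk)) fun W' g hg => ?_
    refine (completion P J).le_join T _ hg W' ?_
    refine DownSet.mem_closure_of_mem J _ ⟨𝟙 W'.base, self_mem_principal_closure W', ?_⟩
    exact Category.id_comp _

/-- The unit is locally full: an arrow into `η(x)` is a pair in the `J`-closure of `↓x`, hence locally
a pair in `↓x`. -/
theorem imageSieve_unitTotal_mem {W X : TotalCat P}
    (h : (unitTotal J).obj W ⟶ (unitTotal J).obj X) : (unitTotal J).imageSieve h ∈ J W := by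
  refine J.superset_covering ?_ ((mem_principal_closure_iff X.elt _).1 (base_mem_closedSet h))
  intro W' g hg
  exact ⟨⟨g.base ≫ h.base, hg⟩, TotalCat.Hom.ext rfl⟩

theorem unitTotal_map_injective {W X : TotalCat P} {f g : W ⟶ X}
    (h : (unitTotal J).map f = (unitTotal J).map g) : f = g :=
  TotalCat.Hom.ext (congrArg (proj (completion P J).doc).map h)

theorem functorPushforward_unitTotal_mem_iff {X : TotalCat P} {S : Sieve X} :
    S.functorPushforward (unitTotal J) ∈ (completion P J).topology _ ↔ S ∈ J X := by
  rw [mem_completion_topology_iff]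
  constructor
  · intro h
    refine J.transitive (h X (𝟙 _)) _ ?_
    rintro W g ⟨Y, u, l, hu, e⟩
    refine J.superset_covering ?_ (imageSieve_unitTotal_mem l)
    rintro W' v ⟨m, hm⟩
    have : v ≫ g = m ≫ u := unitTotal_map_injective (J := J) (by
      rw [Category.comp_id] at e
      rw [Functor.map_comp, Functor.map_comp, hm, Category.assoc, ← e])
    change S (v ≫ g)
    rw [this]
    exact S.downward_closed hu m
  · intro hS W h
    refine J.transitive (imageSieve_unitTotal_mem h) _ ?_
    rintro W' g ⟨m, hm⟩
    refine J.superset_covering ?_ (J.pullback_stable m hS)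
    intro W'' v hv
    refine ⟨_, v ≫ m, 𝟙 _, hv, ?_⟩
    simp [hm]

instance unitTotal_isDenseSubsite :
    (unitTotal J).IsDenseSubsite J (completion P J).topology where
  isCoverDense' := ⟨fun U => mem_completion_topology_iff.2 fun W h => by
    convert J.top_mem W
    ext W' g
    exact ⟨fun _ => trivial, fun _ => ⟨⟨W', 𝟙 _, (unitTotal J).map g ≫ h, by simp⟩⟩⟩⟩
  isLocallyFull' := ⟨fun h =>
    functorPushforward_unitTotal_mem_iff.2 (imageSieve_unitTotal_mem h)⟩
  isLocallyFaithful' := ⟨fun f g h => by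
    obtain rfl := unitTotal_map_injective h
    simp⟩
  functorPushforward_mem_iff := functorPushforward_unitTotal_mem_iff

variable (P J) in
theorem completionUnit_isDocSiteMorphism :
    IsDocSiteMorphism J (completion P J).topology (𝟭 C) (completionUnit P J) where
  flat := isFlat_id
  total := isMorphismOfSites_of_isDenseSubsite (unitTotal J)

end Unit

/-! ### The universal property of the completion -/

section Flatness

variable {C : Type u} [Category.{v} C] {D : Type u₂} [Category.{v₂} D] {F : C ⥤ D}

theorem IsFlat.exists_pair (hF : IsFlat F) {c₁ c₂ : C} {d : D} (g₁ : d ⟶ F.obj c₁)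
    (g₂ : d ⟶ F.obj c₂) : ∃ (c : C) (f₁ : c ⟶ c₁) (f₂ : c ⟶ c₂) (k : d ⟶ F.obj c),
      g₁ = k ≫ F.map f₁ ∧ g₂ = k ≫ F.map f₂ := by
  obtain ⟨R, hR, h⟩ := hF.pair g₁ g₂
  obtain rfl := (GrothendieckTopology.bot_covering).1 hR
  simpa using h (𝟙 d) trivial

theorem IsFlat.exists_equalize (hF : IsFlat F) {c' c : C} {f₁ f₂ : c' ⟶ c} {d : D}
    {g : d ⟶ F.obj c'} (hg : g ≫ F.map f₁ = g ≫ F.map f₂) :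
    ∃ (c'' : C) (e : c'' ⟶ c') (k : d ⟶ F.obj c''), e ≫ f₁ = e ≫ f₂ ∧ g = k ≫ F.map e := by
  obtain ⟨R, hR, h⟩ := hF.equalize f₁ f₂ g hg
  obtain rfl := (GrothendieckTopology.bot_covering).1 hR
  simpa using h (𝟙 d) trivial

end Flatness

section Universal

variable {C : Type u} [Category.{v} C] {D : Type u₂} [Category.{v₂} D] {F : C ⥤ D}
  {P : Doctrine.{w} C} {J : GrothendieckTopology (TotalCat P)} {L : GeometricDoctrine.{w₂} D}

theorem OpenFrameDoctrine.map_comp_apply (L : OpenFrameDoctrine.{w₂} D) {c d e : D} (g : e ⟶ d)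
    (f : d ⟶ c) (U : L.frm.obj (op c)) :
    L.frm.map (g ≫ f).op U = L.frm.map g.op (L.frm.map f.op U) := by
  rw [op_comp, L.frm.map_comp]
  rfl

theorem OpenFrameDoctrine.map_mono (L : OpenFrameDoctrine.{w₂} D) {c d : D} (f : d ⟶ c)
    {U V : L.frm.obj (op c)} (h : U ≤ V) : L.frm.map f.op U ≤ L.frm.map f.op V :=
  (L.gc f).monotone_u h

/-- The value at `x` of a natural transformation into a geometric doctrine, as an element of the
frame. -/
def DocTrans.value {P : Doctrine.{w} C} (a : DocTrans F P L.doc) (X : TotalCat P) :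
    L.frm.obj (op (F.obj X.base)) :=
  a.app X.base X.elt

namespace DocTrans

section Value

variable (a : DocTrans F P L.doc)

theorem value_le {X Y : TotalCat P} (g : Y ⟶ X) :
    a.value Y ≤ L.frm.map (F.map g.base).op (a.value X) :=
  (a.total.map g).elt_le

variable {a}

/-- An element dominating the images of all members of a `J`-covering sieve dominates the image of
the object covered. -/
theorem value_le_of_cover (ha : IsMorphismOfSites J L.topology a.total) {X : TotalCat P}
    {S : Sieve X} (hS : S ∈ J X) (U : L.frm.obj (op (F.obj X.base)))
    (h : ∀ (Y : TotalCat P) (g : Y ⟶ X), S g → a.value Y ≤ L.frm.map (F.map g.base).op U) :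
    a.value X ≤ U := by
  have hc : L.join (S.functorPushforward a.total) = a.value X := ha.cover_preserving hS
  rw [← hc]
  refine (L.join_le_iff _ _).2 ?_
  rintro Z f ⟨Y, g, l, hg, rfl⟩
  refine (L.gc _).l_le (le_trans l.elt_le ?_)
  exact (L.map_mono l.base (h Y g hg)).trans_eq (L.map_comp_apply l.base (F.map g.base) U).symm

end Value

/-- The closed set of all pairs `(k, x)` with `a(x) ≤ L(F(k))(U)`. -/
def largestClosedSet {a : DocTrans F P L.doc} (ha : IsMorphismOfSites J L.topology a.total) {c : C}
    (U : L.frm.obj (op (F.obj c))) : ClosedSet J c :=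
  ⟨{ mem := fun X => {k | a.value X ≤ L.frm.map (F.map k).op U}
     down := fun {X Y} g {k} hk => by
      change a.value Y ≤ L.frm.map (F.map (g.base ≫ k)).op U
      rw [F.map_comp, L.map_comp_apply]
      exact (a.value_le g).trans (L.map_mono _ hk) },
    fun X k hk => value_le_of_cover ha hk _ fun Y g hg => by
      have hg : a.value Y ≤ L.frm.map (F.map (g.base ≫ k)).op U := hg
      rwa [F.map_comp, L.map_comp_apply] at hg⟩

/-- The join of all `∃_{F(k)} a(x)` over the pairs `(k, x)` of a closed set. -/
noncomputable def extendFun (a : DocTrans F P L.doc) {c : C} (S : ClosedSet J c) :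
    L.frm.obj (op (F.obj c)) :=
  ⨆ (X : TotalCat P) (k : X.base ⟶ c) (_ : k ∈ S.mem X), L.ex (F.map k) (a.value X)

theorem extendFun_le_iff {a : DocTrans F P L.doc} {c : C} (S : ClosedSet J c)
    (U : L.frm.obj (op (F.obj c))) :
    a.extendFun S ≤ U ↔ ∀ (X : TotalCat P) (k : X.base ⟶ c), k ∈ S.mem X →
      a.value X ≤ L.frm.map (F.map k).op U := by
  simp only [extendFun, iSup_le_iff]
  exact forall₃_congr fun X k _ => (L.gc (F.map k)).le_iff_le

theorem value_le_extendFun (a : DocTrans F P L.doc) {c : C} {S : ClosedSet J c} {X : TotalCat P}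
    {k : X.base ⟶ c} (hk : k ∈ S.mem X) :
    a.value X ≤ L.frm.map (F.map k).op (a.extendFun S) :=
  (extendFun_le_iff S _).1 le_rfl X k hk

theorem extendFun_le_iff_le_largestClosedSet {a : DocTrans F P L.doc}
    (ha : IsMorphismOfSites J L.topology a.total) {c : C} (S : ClosedSet J c)
    (U : L.frm.obj (op (F.obj c))) : a.extendFun S ≤ U ↔ S ≤ largestClosedSet ha U :=
  extendFun_le_iff S U

theorem extendFun_mono (a : DocTrans F P L.doc) {c : C} {S T : ClosedSet J c} (h : S ≤ T) :
    a.extendFun S ≤ a.extendFun T :=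
  (extendFun_le_iff _ _).2 fun X _ hk => a.value_le_extendFun (h X hk)

/-- The sieve of all arrows that factor through `a(x)` for some pair `(k, x)` of a closed set. -/
def extendSieve (a : DocTrans F P L.doc) {c : C} (S : ClosedSet J c) :
    Sieve (⟨F.obj c, a.extendFun S⟩ : TotalCat L.doc) where
  arrows Y h := ∃ (X : TotalCat P) (k : X.base ⟶ c) (_ : k ∈ S.mem X)
    (m : Y.base ⟶ F.obj X.base), L.val Y ≤ L.frm.map m.op (a.value X) ∧ h.base = m ≫ F.map k
  downward_closed := by
    rintro Y Z h ⟨X, k, hk, m, hm, e⟩ l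
    refine ⟨X, k, hk, l.base ≫ m, ?_, ?_⟩
    · rw [L.map_comp_apply]
      exact le_trans l.elt_le (L.map_mono l.base hm)
    · rw [TotalCat.base_comp, e, Category.assoc]

theorem extendSieve_mem (a : DocTrans F P L.doc) {c : C} (S : ClosedSet J c) :
    a.extendSieve S ∈ L.topology _ := by
  refine le_antisymm (L.join_le _) ((extendFun_le_iff S _).2 fun X k hk => ?_)
  refine (L.gc _).le_iff_le.1 ?_
  let f : a.total.obj X ⟶ (⟨F.obj c, a.extendFun S⟩ : TotalCat L.doc) :=
    ⟨F.map k, a.value_le_extendFun hk⟩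
  exact L.le_join (a.extendSieve S) f 
    ⟨X, k, hk, 𝟙 (F.obj X.base), by
      change a.value X ≤ L.frm.map (𝟙 (F.obj X.base)).op (a.value X)
      simp, (Category.id_comp (F.map k)).symm⟩

/-- The extension is natural. The inequality from right to left combines the Beck-Chevalley
condition of `L` with the flatness of `F`. -/
theorem extendFun_restrict (a : DocTrans F P L.doc) (hF : IsFlat F) {c d : C} (f : d ⟶ c)
    (S : ClosedSet J c) :
    a.extendFun (ClosedSet.restrict f S) = L.frm.map (F.map f).op (a.extendFun S) := by
  apply le_antisymm
  · refine (extendFun_le_iff _ _).2 fun X k hk => ?_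
    have := a.value_le_extendFun (S := S) (k := k ≫ f) hk
    rwa [F.map_comp, L.map_comp_apply] at this
  · rw [← L.beckChevalley (F.map f) (a.extendFun S) (a.extendSieve S) (a.extendSieve_mem S)]
    refine (L.join_le_iff _ _).2 ?_
    rintro Y g ⟨X, k, hk, m, h₁, e⟩
    refine (L.gc _).l_le ?_
    have e : g.base ≫ F.map f = m ≫ F.map k := e
    obtain ⟨c₁, p, q, n, hp, rfl⟩ := hF.exists_pair g.base m
    obtain ⟨c₂, r, n', hr, rfl⟩ := hF.exists_equalize (f₁ := p ≫ f) (f₂ := q ≫ k) (g := n) (by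
      rw [F.map_comp, F.map_comp, ← Category.assoc, ← Category.assoc, ← hp, e])
    let X' : TotalCat P := ⟨c₂, P.map (r ≫ q).op X.elt⟩
    have hX' : r ≫ p ∈ (ClosedSet.restrict f S).mem X' := by
      change (r ≫ p) ≫ f ∈ S.mem X'
      rw [Category.assoc, hr, ← Category.assoc]
      exact S.down (cartesianLift P (r ≫ q) X.elt) hk
    have h₂ : a.value X' = L.frm.map (F.map (r ≫ q)).op (a.value X) := a.naturality _ _
    have hg : g.base = n' ≫ F.map (r ≫ p) := by rw [hp, F.map_comp, Category.assoc]
    rw [Category.assoc, ← F.map_comp, L.map_comp_apply, ← h₂] at h₁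
    rw [hg, L.map_comp_apply]
    exact h₁.trans (L.map_mono _ (a.value_le_extendFun hX'))

theorem extendFun_principal {a : DocTrans F P L.doc}
    (ha : IsMorphismOfSites J L.topology a.total) (X : TotalCat P) :
    a.extendFun ((principal X.elt).closure J) = a.value X := by
  apply le_antisymm
  · rw [extendFun_le_iff_le_largestClosedSet ha, principal_closure_le_iff]
    change a.value X ≤ L.frm.map (F.map (𝟙 X.base)).op (a.value X)
    simp
  · simpa using a.value_le_extendFun (self_mem_principal_closure (J := J) X)

variable (J) in
/-- The extension of a natural transformation along the unit of the completion. -/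
noncomputable def extend (a : DocTrans F P L.doc) (hF : IsFlat F) :
    DocTrans F (completion P J).doc L.doc where
  app c :=
    { toFun := fun S : ClosedSet J c => a.extendFun S
      monotone' := fun S T h => a.extendFun_mono (S := S) (T := T) h }
  naturality f S := a.extendFun_restrict hF f S

theorem extend_isDocSiteMorphism {a : DocTrans F P L.doc}
    (ha : IsDocSiteMorphism J L.topology F a) :
    IsDocSiteMorphism (completion P J).topology L.topology F (a.extend J ha.flat) where
  flat := ha.flat
  total :=
    { cover_preserving := fun {X T} hT => by
        refine le_antisymm (L.join_le _) ?_
        let U : L.frm.obj (op (F.obj X.base)) :=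
          L.join (T.functorPushforward (a.extend J ha.flat).total)
        change a.extendFun (closedSet X) ≤ U
        rw [extendFun_le_iff_le_largestClosedSet ha.total]
        have hT : (completion P J).join T = closedSet X := hT
        rw [← hT]
        refine ((completion P J).join_le_iff T _).2 fun Y f hf => ?_
        refine ((completion P J).gc f.base).l_le ?_
        change closedSet Y ≤ ClosedSet.restrict f.base (largestClosedSet ha.total U)
        intro W k hk
        change a.value W ≤ L.frm.map (F.map (k ≫ f.base)).op U
        rw [F.map_comp, L.map_comp_apply]
        refine (a.value_le_extendFun hk).trans (L.map_mono _ ?_)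
        refine (L.gc _).le_iff_le.1 ?_
        exact L.le_join _ ((a.extend J ha.flat).total.map f)
          (Sieve.image_mem_functorPushforward _ _ hf)
      covered := fun d => by
        obtain ⟨R, hR, h⟩ := ha.total.covered d
        refine ⟨R, hR, fun d' f hf => ?_⟩
        obtain ⟨X, ⟨m⟩⟩ := h f hf
        exact ⟨(unitTotal J).obj X, ⟨⟨m.base, m.elt_le.trans
          (L.map_mono _ (extendFun_principal ha.total X).ge)⟩⟩⟩
      pair := fun {X₁ X₂ Z} g₁ g₂ => by
        let R : Sieve Z :=
          { arrows := fun Z' h => ∃ (X' : TotalCat (completion P J).doc) (f₁ : X' ⟶ X₁)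
              (f₂ : X' ⟶ X₂) (k : Z' ⟶ (a.extend J ha.flat).total.obj X'),
              h ≫ g₁ = k ≫ (a.extend J ha.flat).total.map f₁ ∧
              h ≫ g₂ = k ≫ (a.extend J ha.flat).total.map f₂
            downward_closed := by
              rintro Z' Z'' h ⟨X', f₁, f₂, k, h₁, h₂⟩ l
              exact ⟨X', f₁, f₂, l ≫ k, by simp [h₁], by simp [h₂]⟩ }
        refine ⟨R, ?_, fun _ _ h => h⟩
        refine L.topology.transitive (L.topology.intersection_covering
          (L.topology.pullback_stable g₁ (a.extendSieve_mem (closedSet X₁)))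
          (L.topology.pullback_stable g₂ (a.extendSieve_mem (closedSet X₂)))) _ ?_
        rintro Z' h ⟨⟨W₁, k₁, hk₁, m₁, hm₁, e₁⟩, ⟨W₂, k₂, hk₂, m₂, hm₂, e₂⟩⟩
        obtain ⟨R', hR', hpair⟩ := ha.total.pair (c₁ := W₁) (c₂ := W₂) (d := Z')
          ⟨m₁, hm₁⟩ ⟨m₂, hm₂⟩
        refine L.topology.superset_covering ?_ hR'
        intro Z'' l hl
        obtain ⟨W, f₁, f₂, n, h₁, h₂⟩ := hpair l hl
        let nb : Z''.base ⟶ F.obj W.base := n.base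
        let n' : Z'' ⟶ (a.extend J ha.flat).total.obj ((unitTotal J).obj W) :=
          ⟨n.base, n.elt_le.trans (L.map_mono _ (extendFun_principal ha.total W).ge)⟩
        refine ⟨(unitTotal J).obj W, (unitTotal J).map f₁ ≫ arrowOfMem k₁ hk₁,
          (unitTotal J).map f₂ ≫ arrowOfMem k₂ hk₂, n', ?_, ?_⟩
        · apply TotalCat.Hom.ext
          have h₁ : l.base ≫ m₁ = nb ≫ F.map f₁.base := congrArg (proj L.doc).map h₁
          let gb : Z.base ⟶ F.obj X₁.base := g₁.base
          have e₁ : h.base ≫ gb = m₁ ≫ F.map k₁ := e₁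
          change (l.base ≫ h.base) ≫ gb = nb ≫ F.map (f₁.base ≫ k₁)
          rw [Category.assoc, e₁, ← Category.assoc, h₁, F.map_comp, Category.assoc]
        · apply TotalCat.Hom.ext
          have h₂ : l.base ≫ m₂ = nb ≫ F.map f₂.base := congrArg (proj L.doc).map h₂
          let gb : Z.base ⟶ F.obj X₂.base := g₂.base
          have e₂ : h.base ≫ gb = m₂ ≫ F.map k₂ := e₂
          change (l.base ≫ h.base) ≫ gb = nb ≫ F.map (f₂.base ≫ k₂)
          rw [Category.assoc, e₂, ← Category.assoc, h₂, F.map_comp, Category.assoc]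
      equalize := fun {X' X} f₁ f₂ Z g hg => by
        refine ⟨_, L.topology.pullback_stable g (a.extendSieve_mem (closedSet X')), ?_⟩
        rintro Z' h ⟨W, k, hk, m, hle, e⟩
        let gb : Z.base ⟶ F.obj X'.base := g.base
        have e : h.base ≫ gb = m ≫ F.map k := e
        have hg : gb ≫ F.map f₁.base = gb ≫ F.map f₂.base := congrArg (proj L.doc).map hg
        -- the two arrows out of the base of `W` have no common codomain in the total category
        -- of `P`: they are equalized in the base, by flatness of `F`, and `W` is restricted
        obtain ⟨c, r, n, hr, rfl⟩ := ha.flat.exists_equalize (f₁ := k ≫ f₁.base)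
          (f₂ := k ≫ f₂.base) (g := m) (by
            rw [F.map_comp, F.map_comp, ← Category.assoc, ← Category.assoc, ← e,
              Category.assoc, Category.assoc, hg])
        let W' : TotalCat P := ⟨c, P.map r.op W.elt⟩
        have hW' : a.value W' = L.frm.map (F.map r).op (a.value W) := a.naturality _ _
        rw [L.map_comp_apply, ← hW'] at hle
        refine ⟨(unitTotal J).obj W', (unitTotal J).map (cartesianLift P r W.elt) ≫
          arrowOfMem k hk, ⟨n, hle.trans (L.map_mono _ (extendFun_principal ha.total W').ge)⟩,
          ?_, ?_⟩
        · apply TotalCat.Hom.ext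
          change (r ≫ k) ≫ f₁.base = (r ≫ k) ≫ f₂.base
          rw [Category.assoc, hr, Category.assoc]
        · apply TotalCat.Hom.ext
          change h.base ≫ gb = n ≫ F.map (r ≫ k)
          rw [e, F.map_comp, Category.assoc] }

/-- A natural transformation that preserves covers is determined by its restriction along the
unit, since each closed set is covered by the principal ones contained in it. -/
theorem app_le_of_unit_eq {b₁ b₂ : DocTrans F (completion P J).doc L.doc}
    (h₁ : IsMorphismOfSites (completion P J).topology L.topology b₁.total)
    (h : ∀ (c : C) (x : P.obj (op c)), b₁.app c ((completionUnit P J).app c x) =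
      b₂.app c ((completionUnit P J).app c x)) (X : TotalCat (completion P J).doc) :
    b₁.value X ≤ b₂.value X := by
  have := Functor.IsDenseSubsite.isCoverDense J (completion P J).topology (unitTotal J)
  refine value_le_of_cover h₁
    ((unitTotal J).is_cover_of_isCoverDense (completion P J).topology X) _ ?_
  rintro Y _ ⟨⟨W, p, q, rfl⟩⟩
  have hW : b₁.value ((unitTotal J).obj W) = b₂.value ((unitTotal J).obj W) := h W.base W.elt
  refine (b₁.value_le p).trans ?_
  rw [hW, TotalCat.base_comp, F.map_comp, L.map_comp_apply]
  exact L.map_mono _ (b₂.value_le q)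

theorem existsUnique_extend {a : DocTrans F P L.doc} (ha : IsDocSiteMorphism J L.topology F a) :
    ∃! b : DocTrans F (completion P J).doc L.doc,
      IsDocSiteMorphism (completion P J).topology L.topology F b ∧
        ∀ (c : C) (x : P.obj (op c)), b.app c ((completionUnit P J).app c x) = a.app c x := by
  have hunit : ∀ (c : C) (x : P.obj (op c)),
      (a.extend J ha.flat).app c ((completionUnit P J).app c x) = a.app c x :=
    fun c x => extendFun_principal ha.total ⟨c, x⟩
  refine ⟨a.extend J ha.flat, ⟨extend_isDocSiteMorphism ha, hunit⟩, ?_⟩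
  rintro b ⟨hb, hb'⟩
  have happ : b.app = (a.extend J ha.flat).app := by
    ext c S
    exact le_antisymm (α := L.frm.obj (op (F.obj c)))
      (app_le_of_unit_eq hb.total (fun c x => (hb' c x).trans (hunit c x).symm) ⟨c, S⟩)
      (app_le_of_unit_eq (extend_isDocSiteMorphism ha).total
        (fun c x => (hunit c x).trans (hb' c x).symm) ⟨c, S⟩)
  cases b
  cases happ
  rfl

end DocTrans

end Universal

/-! ### The completion as a right Kan extension of the subobject classifier -/

section DirectImage

variable {C : Type u} [Category.{v} C] (P : Doctrine.{w} C) (J : GrothendieckTopology (TotalCat P))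

/-- The underlying presheaf of sets of the completion. -/
abbrev completionPresheaf : Cᵒᵖ ⥤ Type (max u v w) :=
  (completion P J).frm ⋙ forget Frm

variable {P J} in
/-- The sieve underlying an element of the subobject classifier. -/
def omegaSieve {X : TotalCat P} (R : (omega J).obj.obj (op X)) : Sieve X := R.1

variable {P J} in
theorem omega_ext {X : TotalCat P} {R R' : (omega J).obj.obj (op X)}
    (h : ∀ (Y : TotalCat P) (g : Y ⟶ X), omegaSieve R g ↔ omegaSieve R' g) : R = R' :=
  Subtype.ext (Sieve.ext h)

/-- The comparison of the inverse image of the completion with the subobject classifier. -/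
def completionCounit : (proj P).op ⋙ completionPresheaf P J ⟶ (omega J).obj where
  app X := ↾fun S : ClosedSet J X.unop.base => ClosedSet.toOmega J X.unop S
  naturality X Y g := by
    ext S
    change ClosedSet J X.unop.base at S
    refine omega_ext fun Z h => ?_
    change (h.base ≫ 𝟙 _) ≫ g.unop.base ∈ S.mem Z ↔ (h.base ≫ g.unop.base) ≫ 𝟙 _ ∈ S.mem Z
    simp

variable {P J}

theorem mem_completionCounit_iff {X Y : TotalCat P} (S : ClosedSet J X.base) (g : Y ⟶ X) :
    omegaSieve (ClosedSet.toOmega J X S) g ↔ g.base ∈ S.mem Y := by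
  change g.base ≫ 𝟙 _ ∈ S.mem Y ↔ _
  rw [Category.comp_id]

section Lift

variable {G : Cᵒᵖ ⥤ Type (max u v w)} (β : (proj P).op ⋙ G ⟶ (omega J).obj)

/-- The `J`-closed sieve that `β` assigns to an element of `G`. -/
def classifiedSieve (X : TotalCat P) (s : G.obj (op X.base)) : Sieve X :=
  omegaSieve (β.app (op X) s)

theorem classifiedSieve_isClosed (X : TotalCat P) (s : G.obj (op X.base)) :
    J.IsClosed (classifiedSieve β X s) :=
  (β.app (op X) s).2

theorem classifiedSieve_map {X Y : TotalCat P} (g : Y ⟶ X) (s : G.obj (op X.base)) :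
    classifiedSieve β Y (G.map g.base.op s) = (classifiedSieve β X s).pullback g := by
  have h : β.app (op Y) (G.map g.base.op s) = (omega J).obj.map g.op (β.app (op X) s) :=
    NatTrans.naturality_apply β g.op s
  exact congrArg omegaSieve h

theorem classifiedSieve_map_id_iff {X Y : TotalCat P} (g : Y ⟶ X) (s : G.obj (op X.base)) :
    classifiedSieve β Y (G.map g.base.op s) (𝟙 Y) ↔ classifiedSieve β X s g := by
  rw [classifiedSieve_map, Sieve.pullback_apply, Category.id_comp]

theorem classifiedSieve_map_comp_id_iff {c : C} {X Y : TotalCat P} (g : Y ⟶ X) (k : X.base ⟶ c)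
    (s : G.obj (op c)) :
    classifiedSieve β Y (G.map (g.base ≫ k).op s) (𝟙 Y) ↔
      classifiedSieve β X (G.map k.op s) g := by
  rw [op_comp, Functor.map_comp_apply]
  exact classifiedSieve_map_id_iff β g _

/-- The set of pairs `(k, x)` for which `β` classifies the maximal sieve at the restriction of an
element along `k`. -/
def classifiedClosedSet {c : C} (s : G.obj (op c)) : ClosedSet J c :=
  ⟨{ mem := fun X => {k | classifiedSieve β X (G.map k.op s) (𝟙 X)}
     down := fun {X Y} g {k} hk => by
      change classifiedSieve β Y (G.map (g.base ≫ k).op s) (𝟙 Y)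
      rw [classifiedSieve_map_comp_id_iff]
      simpa using (classifiedSieve β X (G.map k.op s)).downward_closed hk g },
    fun X k hk => by
      refine classifiedSieve_isClosed β X _ (𝟙 X) ?_
      change (classifiedSieve β X (G.map k.op s)).pullback (𝟙 X) ∈ J X
      rw [Sieve.pullback_id]
      exact J.superset_covering (fun Y g hg => (classifiedSieve_map_comp_id_iff β g k s).1 hg) hk⟩

/-- The transpose of a natural transformation into the subobject classifier. -/
def classifyingMap : G ⟶ completionPresheaf P J where
  app c := ↾fun s => classifiedClosedSet β s
  naturality c d f := by
    ext s
    refine ClosedSet.ext (J := J) fun X k => ?_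
    change classifiedSieve β X (G.map k.op (G.map f s)) (𝟙 X) ↔
      classifiedSieve β X (G.map (k ≫ f.unop).op s) (𝟙 X)
    rw [op_comp, Functor.map_comp_apply]
    rfl

theorem classifyingMap_fac :
    (proj P).op.whiskerLeft (classifyingMap β) ≫ completionCounit P J = β := by
  ext X s
  refine omega_ext fun Y g => ?_
  refine (mem_completionCounit_iff (X := X.unop) (classifiedClosedSet β s) g).trans ?_
  exact classifiedSieve_map_id_iff β g s

/-- Uniqueness of the transpose: a pair `(k, x)` belongs to a closed set exactly when the restriction
of that set along `k` yields the maximal sieve on `x`. -/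
theorem eq_classifyingMap (γ : G ⟶ completionPresheaf P J)
    (h : (proj P).op.whiskerLeft γ ≫ completionCounit P J = β) : γ = classifyingMap β := by
  subst h
  ext c s
  refine ClosedSet.ext (J := J) fun X k => ?_
  let T : ClosedSet J c.unop := γ.app c s
  have e : γ.app (op X.base) (G.map k.op s) = ClosedSet.restrict k T :=
    NatTrans.naturality_apply γ k.op s
  change k ∈ T.mem X ↔
    omegaSieve (ClosedSet.toOmega J X (γ.app (op X.base) (G.map k.op s))) (𝟙 X)
  rw [e, mem_completionCounit_iff]
  change _ ↔ 𝟙 X.base ≫ k ∈ T.mem X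
  rw [Category.id_comp]

end Lift

instance completionPresheaf_isRightKanExtension :
    (completionPresheaf P J).IsRightKanExtension (completionCounit P J) where
  nonempty_isUniversal := ⟨Limits.IsTerminal.ofUniqueHom
    (fun E => CostructuredArrow.homMk (classifyingMap (J := J) E.hom)
      (classifyingMap_fac (J := J) E.hom))
    (fun E m => CostructuredArrow.hom_ext _ _
      (eq_classifyingMap (J := J) E.hom m.left (CostructuredArrow.w m)))⟩

variable (P J)

theorem exists_iso_directImageOmega :
    ∃ i : (completion P J).frm ⋙ forget Frm ≅ directImageOmega P J,
      ∀ (X : TotalCat P) (S : ClosedSet J X.base),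
        directImageCounit P J X (i.hom.app (op X.base) S) = ClosedSet.toOmega J X S := by
  refine ⟨Functor.rightKanExtensionUnique (completionPresheaf P J) (completionCounit P J)
    ((proj P).op.ran.obj (omega J).obj) ((proj P).op.ranCounit.app (omega J).obj), fun X S => ?_⟩
  exact ConcreteCategory.congr_hom (Functor.liftOfIsRightKanExtension_fac_app
    ((proj P).op.ran.obj (omega J).obj) ((proj P).op.ranCounit.app (omega J).obj)
    (completionPresheaf P J) (completionCounit P J ≫ (Iso.refl _).hom) (op X)) S

end DirectImage

/-! ### Idempotency -/

section Idempotency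

variable {C : Type u} [Category.{v} C]

/-- The identity transformation of a doctrine. -/
def DocTrans.id (P : Doctrine.{w} C) : DocTrans (𝟭 C) P P where
  app _ := OrderHom.id
  naturality _ _ := rfl

theorem DocTrans.id_isDocSiteMorphism {P : Doctrine.{w} C} (J : GrothendieckTopology (TotalCat P)) :
    IsDocSiteMorphism J J (𝟭 C) (DocTrans.id P) where
  flat := isFlat_id
  total := isMorphismOfSites_id J

/-- A geometric doctrine is isomorphic to its own completion: the inverse of the unit is the
extension of the identity. -/
theorem GeometricDoctrine.exists_inverse_completionUnit (L : GeometricDoctrine.{w} C) :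
    ∃ e : DocTrans (𝟭 C) (completion L.doc L.topology).doc L.doc,
      IsDocSiteMorphism (completion L.doc L.topology).topology L.topology (𝟭 C) e ∧
        (∀ (c : C) (U : L.doc.obj (op c)),
          e.app c ((completionUnit L.doc L.topology).app c U) = U) ∧
        ∀ (c : C) (T : (completion L.doc L.topology).doc.obj (op c)),
          (completionUnit L.doc L.topology).app c (e.app c T) = T := by
  let a := DocTrans.id L.doc
  have ha : IsDocSiteMorphism L.topology L.topology (𝟭 C) a := DocTrans.id_isDocSiteMorphism _
  refine ⟨a.extend L.topology ha.flat, DocTrans.extend_isDocSiteMorphism ha,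
    fun c U => DocTrans.extendFun_principal ha.total ⟨c, U⟩, fun c T => ?_⟩
  change ClosedSet L.topology c at T
  let U : L.doc.obj (op c) := a.extendFun T
  change (principal U).closure L.topology = T
  apply le_antisymm
  · -- the join of `T` is covered by the members of `T`, hence belongs to the closed set `T`
    refine (principal_closure_le_iff _ _ _).2 ?_
    refine T.closed (X := ⟨c, U⟩) (𝟙 c) _ (a.extendSieve_mem T) ?_
    rintro Y g ⟨X, k, hk, m, hm, e⟩
    have e : g.base = m ≫ k := e
    rw [Category.comp_id, e]
    exact T.down (Y := Y) (X := X) ⟨m, hm⟩ hk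
  · intro X k hk
    exact DownSet.mem_closure_of_mem _ _ (a.value_le_extendFun hk)

end Idempotency

end Doctrines

open Doctrines
theorem theorem4p10
    {C : Type u} [Category.{v} C] (P : Doctrine.{w} C) (J : GrothendieckTopology (TotalCat P)) :
    -- the geometric completion is the direct image of the subobject classifier
    (∃ i : (completion P J).frm ⋙ forget Frm ≅ directImageOmega P J,
      ∀ (X : TotalCat P) (S : ClosedSet J X.base),
        directImageCounit P J X (i.hom.app (op X.base) S) = ClosedSet.toOmega J X S) ∧
    -- the unit is a morphism of doctrinal sites
    IsDocSiteMorphism J (completion P J).topology (𝟭 C) (completionUnit P J) ∧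
    -- universality
    (∀ {D : Type u₂} [Category.{v₂} D] (L : GeometricDoctrine.{w₂} D) (F : C ⥤ D)
      (a : DocTrans F P L.doc), IsDocSiteMorphism J L.topology F a →
      ∃! b : DocTrans F (completion P J).doc L.doc,
        IsDocSiteMorphism (completion P J).topology L.topology F b ∧
          ∀ (c : C) (x : P.obj (op c)), b.app c ((completionUnit P J).app c x) = a.app c x) ∧
    -- semantic invariance
    (∀ (M : Type u₃) [Category.{v₃} M],
      Nonempty (M ≌ ContinuousFlat.{max u v w} J) →
        Nonempty (M ≌ ContinuousFlat.{max u v w} (completion P J).topology)) ∧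
    -- idempotency
    (∃ e : DocTrans (𝟭 C) (completion (completion P J).doc (completion P J).topology).doc
        (completion P J).doc,
      IsDocSiteMorphism
          (completion (completion P J).doc (completion P J).topology).topology
          (completion P J).topology (𝟭 C) e ∧
        (∀ (c : C) (S : (completion P J).doc.obj (op c)),
          e.app c ((completionUnit (completion P J).doc (completion P J).topology).app c S) = S) ∧
        ∀ (c : C)
          (T : (completion (completion P J).doc (completion P J).topology).doc.obj (op c)),
          (completionUnit (completion P J).doc (completion P J).topology).app c (e.app c T) = T) := by
  refine ⟨exists_iso_directImageOmega P J, completionUnit_isDocSiteMorphism P J,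
    fun L F a ha => DocTrans.existsUnique_extend ha, fun M _ ⟨e⟩ => ⟨e.trans ?_⟩,
    (completion P J).exists_inverse_completionUnit⟩
  exact (continuousFlatEquivalence.{max u v w} (unitTotal J) J (completion P J).topology).symm
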